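/- **Theorem (One-step noisy SGD is $f$-membership inference private).** *Definitions.* For probability measures $P,Q$ on the same space and $\alpha\in[0,1]$ let $\mathrm{Test}(P;Q)(\alpha)=\inf\{1-\int\varphi\,dQ\}$, the infimum over all measurable $\varphi$ with values in $[0,1]$ and $\int\varphi\,dP=\alpha$. A trade-off function is a convex, non-increasing $f:[0,1]\to[0,1]$ that is continuous at $0$ and satisfies $f(r)\le 1-r$. Let $\mathcal D$ be a probability measure on a measurable space $\mathcal X$. Suppose the output of a mechanism has law $A_0$ if a test point $x'$ is not in the training set and $A_1(x')$ if it is. The mechanism is *$f$-MIP* with respect to $\mathcal D$ if $f$ is a trade-off function and for every $\alpha\in[0,1]$ $$\inf_{\bar\alpha}\ \mathbb E_{x'\sim\mathcal D}\big[\mathrm{Test}(A_0;A_1(x'))(\bar\alpha(x'))\big]\ \ge\ f(\alpha),$$ the infimum over all measurable $\bar\alpha:\mathcal X\to[0,1]$ with $\mathbb E_{x'\sim\mathcal D}[\bar\alpha(x')]=\alpha$. *Setting.* Let $d\ge1$, let $g:\mathcal X\to\mathbb R^d$ be measurable (per-sample gradients), $C\in(0,\infty]$, $\tau\ge0$, and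 let $\theta(x)=g(x)\min(1,C/\|g(x)\|)$ be the clipped gradient ($\theta=g$ if $C=\infty$). For $x\sim\mathcal D$ let $\theta(x)$ be square integrable with mean $\mu$ and positive definite covariance $\Sigma$, put $\kappa(x')=\|\Sigma^{-1/2}(\theta(x')-\mu)\|_2^2$, and let $K\ge\kappa(x')$ for $\mathcal D$-almost every $x'$. One step of noisy SGD maps a batch $(x_1,\dots,x_n)$ to $\frac1n\sum_{i=1}^n\theta(x_i)+Y$ with independent noise $Y\sim\mathcal N(0,\tau^2I)$. Let $n_{\text{eff}}=n+\tau^2n^2/C^2$ (equal to $n$ if $C=\infty$), let $F_{\chi^2_d(\gamma)}:[0,\infty]\to[0,1]$ be the distribution function of the non-central chi-squared distribution with $d$ degrees of freedom and non-centrality $\gamma$, let $F^{-1}_{\chi^2_d(\gamma)}:[0,1]\to[0,\infty]$ be its quantile function, and $$\beta_{N,\gamma}(\alpha)=1-F_{\chi^2_d((N-1)\gamma)}\Big(\tfrac{N}{N-1}F^{-1}_{\chi^2_d(N\gamma)}(\alpha)\Big).$$ *Central limit model* with noise covariance $V$: in $A_0$ and $A_1(x')$ the sum of the $k$ independently sampled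 gradients ($k=n$, respectively $k=n-1$) is replaced by an $\mathcal N(k\mu,k\Sigma)$ vector, so that $$A_0=\mathcal N\big(\mu,\tfrac1n\Sigma+V\big),\qquad A_1(x')=\mathcal N\big(\tfrac1n\theta(x')+\tfrac{n-1}n\mu,\ \tfrac{n-1}{n^2}\Sigma+V\big).$$ *Claims.* 1. For every $n\ge2$, in the central limit model with $V=\tau^2I$, one step of noisy SGD is $f$-MIP with respect to $\mathcal D$ with $f=\beta_{n_{\text{eff}},K}$. 2. For every $n\ge2$, $\sigma\in\mathbb R$, $x'\in\mathcal X$ and $\alpha\in[0,1]$, in the central limit model with $V=\sigma^2\Sigma$ the optimal test has exactly the trade-off $\mathrm{Test}(A_0;A_1(x'))(\alpha)=\beta_{n+\sigma^2n^2,\,\kappa(x')}(\alpha)$. 3. If $\tau>0$, there is a constant $B$, independent of $n$ and $\alpha$, such that for every $n\ge2$ the actual algorithm (without Gaussian replacement: $A_0$ is its output law on $n$ independent samples from $\mathcal D$, and $A_1(x')$ its output law on $x'$ and $n-1$ independent samples from $\mathcal D$) is $f$-MIP with respect to $\mathcal D$ with $f(\alpha)=\max\big(0,\ \beta_{n_{\text{eff}},K}(\alpha)-B/n^2\big)$.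 -/

import Mathlib

open MeasureTheory ProbabilityTheory Set Filter
open scoped ENNReal MatrixOrder

namespace MIP

noncomputable section

/-! ### Trade-off functions, stochastic composition, membership inference privacy -/

/-- The trade-off function of testing `P` (null) against `Q` (alternative): the least false
negative rate `1 - ∫ φ dQ` of a (randomized, measurable) rejection rule `φ` with false positive
rate `∫ φ dP = α`. -/
def tradeoff {Y : Type*} [MeasurableSpace Y] (P Q : Measure Y) (α : ℝ) : ℝ :=
  sInf {β : ℝ | ∃ φ : Y → ℝ, Measurable φ ∧ (∀ y, φ y ∈ Icc (0 : ℝ) 1) ∧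
    ∫ y, φ y ∂P = α ∧ β = 1 - ∫ y, φ y ∂Q}

/-- `f : [0,1] → [0,1]` (its values outside of `[0,1]` are irrelevant) is a trade-off function. -/
structure IsTradeoff (f : ℝ → ℝ) : Prop where
  mapsTo : MapsTo f (Icc 0 1) (Icc 0 1)
  convex : ConvexOn ℝ (Icc 0 1) f
  continuous_zero : ContinuousWithinAt f (Icc 0 1) 0
  antitone : AntitoneOn f (Icc 0 1)
  le_one_sub : ∀ r ∈ Icc (0 : ℝ) 1, f r ≤ 1 - r

/-- The stochastic composition of the trade-off functions `h x`, `x ∼ D`: the least global false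
negative rate `E[h x (a x)]` over all test-specific levels `a : X → [0,1]` with `E[a x] = α`.
The expectation of the nonnegative quantity `h x (a x)` is a Lebesgue integral (for an integrand
that is not measurable this is its lower integral, so that lower bounds are never vacuous). -/
def stochComp {X : Type*} [MeasurableSpace X] (D : Measure X) (h : X → ℝ → ℝ) (α : ℝ) : ℝ :=
  sInf {β : ℝ | ∃ a : X → ℝ, Measurable a ∧ (∀ x, a x ∈ Icc (0 : ℝ) 1) ∧
    ∫ x, a x ∂D = α ∧ β = (∫⁻ x, ENNReal.ofReal (h x (a x)) ∂D).toReal}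

/-- `f`-membership inference privacy with respect to `D`, for a mechanism whose output has law
`A₀` if the test point is not in the training set, and `A₁ x'` if the test point `x'` is. -/
def IsMIP {X Y : Type*} [MeasurableSpace X] [MeasurableSpace Y] (D : Measure X)
    (A₀ : Measure Y) (A₁ : X → Measure Y) (f : ℝ → ℝ) : Prop :=
  IsTradeoff f ∧ ∀ α ∈ Icc (0 : ℝ) 1, f α ≤ stochComp D (fun x' => tradeoff A₀ (A₁ x')) α

/-- Output law of a randomized algorithm `A` on `n = m + 1` independent samples from `D`. -/
def nullLaw {X Y : Type*} [MeasurableSpace X] [MeasurableSpace Y] (D : Measure X) {m : ℕ}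
    (A : (Fin (m + 1) → X) → Measure Y) : Measure Y :=
  (Measure.pi fun _ : Fin (m + 1) => D).bind A

/-- Output law of a randomized algorithm `A` on the point `x'` together with `n - 1 = m`
independent samples from `D`. -/
def memberLaw {X Y : Type*} [MeasurableSpace X] [MeasurableSpace Y] (D : Measure X) {m : ℕ}
    (A : (Fin (m + 1) → X) → Measure Y) (x' : X) : Measure Y :=
  (Measure.pi fun _ : Fin m => D).bind fun S => A (Fin.cons x' S)

/-! ### One step of noisy SGD -/

/-- Clipping at norm `C ∈ (0, ∞]`, i.e. `v * min(1, C / ‖v‖)`. No clipping takes place if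
`C = ∞`. -/
def clip {d : ℕ} (C : ℝ≥0∞) (v : EuclideanSpace ℝ (Fin d)) : EuclideanSpace ℝ (Fin d) :=
  (min 1 (C / ‖v‖ₑ)).toReal • v

/-- One step of noisy SGD with per-sample gradients `g`: the law of the mean of the clipped
gradients of the batch `S` plus an independent `N(0, τ² I)` vector. -/
def noisySGD {X : Type*} {d n : ℕ} (g : X → EuclideanSpace ℝ (Fin d)) (C : ℝ≥0∞) (τ : ℝ)
    (S : Fin n → X) : Measure (EuclideanSpace ℝ (Fin d)) :=
  (multivariateGaussian 0 (τ ^ 2 • (1 : Matrix (Fin d) (Fin d) ℝ))).map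
    fun y => (1 / (n : ℝ)) • (∑ i, clip C (g (S i))) + y

/-- The effective batch size `n + τ² n² / C²` (equal to `n` if `C = ∞`). -/
def nEff (n : ℕ) (τ : ℝ) (C : ℝ≥0∞) : ℝ :=
  n + (ENNReal.ofReal (τ ^ 2 * n ^ 2) / C ^ 2).toReal

/-! ### Moments of the gradients and the central limit model -/

variable {X : Type*} [MeasurableSpace X] {d : ℕ}

/-- The mean `μ` of the gradient `θ x`, `x ∼ D`. -/
def gradMean (D : Measure X) (θ : X → EuclideanSpace ℝ (Fin d)) : EuclideanSpace ℝ (Fin d) :=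
  ∫ x, θ x ∂D

/-- The covariance matrix `Σ` of the gradient `θ x`, `x ∼ D`. -/
def gradCov (D : Measure X) (θ : X → EuclideanSpace ℝ (Fin d)) : Matrix (Fin d) (Fin d) ℝ :=
  Matrix.of fun i j => cov[fun x => θ x i, fun x => θ x j; D]

/-- The gradient susceptibility `‖Σ^(-1/2) (θ x' - μ)‖²` of the test point `x'`. -/
def susceptibility (D : Measure X) (θ : X → EuclideanSpace ℝ (Fin d)) (x' : X) : ℝ :=
  ‖Matrix.toEuclideanCLM (𝕜 := ℝ) (CFC.sqrt (gradCov D θ))⁻¹ (θ x' - gradMean D θ)‖ ^ 2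

/-- The Gaussian law `N(k μ, k Σ)` by which the central limit theorem replaces the law of the sum
of `k` independent gradients with mean `μ` and covariance `Σ`. -/
def cltSum (D : Measure X) (θ : X → EuclideanSpace ℝ (Fin d)) (k : ℕ) :
    Measure (EuclideanSpace ℝ (Fin d)) :=
  multivariateGaussian ((k : ℝ) • gradMean D θ) ((k : ℝ) • gradCov D θ)

/-- Central limit model of the published mean of `n = m + 1` sampled gradients plus independent
`N(0, V)` noise. -/
def cltNullLaw (D : Measure X) (θ : X → EuclideanSpace ℝ (Fin d)) (m : ℕ)
    (V : Matrix (Fin d) (Fin d) ℝ) : Measure (EuclideanSpace ℝ (Fin d)) :=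
  ((cltSum D θ (m + 1)).map fun s => (1 / ((m : ℝ) + 1)) • s).conv (multivariateGaussian 0 V)

/-- Central limit model of the published mean of the gradient of `x'` and `n - 1 = m` sampled
gradients plus independent `N(0, V)` noise. -/
def cltMemberLaw (D : Measure X) (θ : X → EuclideanSpace ℝ (Fin d)) (m : ℕ)
    (V : Matrix (Fin d) (Fin d) ℝ) (x' : X) : Measure (EuclideanSpace ℝ (Fin d)) :=
  ((cltSum D θ m).map fun s => (1 / ((m : ℝ) + 1)) • (θ x' + s)).conv (multivariateGaussian 0 V)

/-! ### Non-central chi-squared distribution and the one-step trade-off -/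

/-- The non-central chi-squared distribution with `d ≥ 1` degrees of freedom and non-centrality
`γ ≥ 0`: the law of `∑ i, (U i + b i)²` for independent standard normal `U i` and a vector `b` with
`∑ i, b i ^ 2 = γ`; the law depends on `b` only through `γ`, and all `b i` are taken equal. -/
def ncChiSq (d : ℕ) (γ : ℝ) : Measure ℝ :=
  (Measure.pi fun _ : Fin d => gaussianReal 0 1).map fun u => ∑ i, (u i + √(γ / d)) ^ 2

/-- Its cumulative distribution function, as a function on `[0, ∞]`. -/
def ncChiSqCDF (d : ℕ) (γ : ℝ) (x : ℝ≥0∞) : ℝ :=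
  (ncChiSq d γ).real {y | ENNReal.ofReal y ≤ x}

/-- The inverse (quantile function) `[0, 1] → [0, ∞]` of the distribution function. -/
def ncChiSqQuantile (d : ℕ) (γ α : ℝ) : ℝ≥0∞ :=
  sInf {x | α ≤ ncChiSqCDF d γ x}

/-- The trade-off
`β(α) = 1 - F_{χ²_d((N-1)K)} (N / (N-1) * F⁻¹_{χ²_d(N K)} (α))`. -/
def oneStepTradeoff (d : ℕ) (N K α : ℝ) : ℝ :=
  1 - ncChiSqCDF d ((N - 1) * K) (ENNReal.ofReal (N / (N - 1)) * ncChiSqQuantile d (N * K) α)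

end

end MIP

/-! Everything rests on one Gaussian testing problem. If the noise covariance is `q Σ`, put `N = n +
q n²` and `δ = Σ^(-1/2) (θ x' - μ)`. The invertible map `z ↦ μ + n⁻¹ Σ^(1/2) z` carries `N(0, N I)`
and `N(δ, (N - 1) I)` to the null and the member law, so the trade-off is that of these two
isotropic laws. Completing the square, their likelihood ratio is a decreasing function of `‖z - N
δ‖²`, so by Neyman–Pearson the optimal tests are balls centred at `N δ`. Their level and power are
non-central chi-squared probabilities; this is claim 2 (`tradeoff_isoGauss`, `tradeoff_clt_eq`).

For claim 1, gradients of norm at most `C` have `Σ ≤ C² I`, hence `τ² I ≥ (τ² / C²) Σ`. The surplus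
noise is post-processing and can only raise the trade-off. Since `β_{N,κ}` decreases in `κ`,
replacing `κ(x')` by `K` gives one convex lower bound for almost all test points, and Jensen's
inequality absorbs the averaging over levels.

Claim 3 is a Lindeberg replacement. Gaussian noise smooths any bounded test: by Cameron–Martin a
shift of the test becomes a density, which is expanded to second order. Exchanging one centred
gradient for a Gaussian vector with the same first two moments thus costs `O(h³)`, uniformly in the
test, where `h = 1 / (n τ)`. At most `n` exchanges cost `O(1 / n²)`. The likelihood ratio is bounded
by `2 ^ d * exp (K / 2)`, whatever `n`, so `β` is Lipschitz uniformly in `n` and the error passes to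
the trade-off. -/

namespace MIP

/-! ### Randomized tests and general properties of trade-off functions -/

section Tradeoff

variable {Y : Type*} [MeasurableSpace Y]

/-- A randomized rejection rule. -/
def IsTest (φ : Y → ℝ) : Prop := Measurable φ ∧ ∀ y, φ y ∈ Icc (0 : ℝ) 1

lemma IsTest.norm_le {φ : Y → ℝ} (h : IsTest φ) (y : Y) : ‖φ y‖ ≤ 1 := by
  rw [Real.norm_eq_abs, abs_of_nonneg (h.2 y).1]; exact (h.2 y).2

lemma IsTest.integrable {φ : Y → ℝ} (h : IsTest φ) (P : Measure Y) [IsFiniteMeasure P] :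
    Integrable φ P :=
  Integrable.of_bound h.1.aestronglyMeasurable 1 (.of_forall h.norm_le)

lemma IsTest.integral_mem {φ : Y → ℝ} (h : IsTest φ) (P : Measure Y) [IsProbabilityMeasure P] :
    ∫ y, φ y ∂P ∈ Icc (0 : ℝ) 1 := by
  refine ⟨integral_nonneg fun y => (h.2 y).1, ?_⟩
  calc ∫ y, φ y ∂P ≤ ∫ _, (1 : ℝ) ∂P :=
        integral_mono (h.integrable P) (integrable_const _) fun y => (h.2 y).2
    _ = 1 := by simp

lemma IsTest.comp {Z : Type*} [MeasurableSpace Z] {φ : Y → ℝ} (h : IsTest φ) {T : Z → Y}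
    (hT : Measurable T) : IsTest fun z => φ (T z) :=
  ⟨h.1.comp hT, fun z => h.2 (T z)⟩

lemma isTest_const {c : ℝ} (hc : c ∈ Icc (0 : ℝ) 1) : IsTest fun _ : Y => c :=
  ⟨measurable_const, fun _ => hc⟩

lemma isTest_indicator {s : Set Y} (hs : MeasurableSet s) : IsTest (s.indicator fun _ => (1 : ℝ)) :=
  ⟨measurable_const.indicator hs, fun y => by by_cases h : y ∈ s <;> simp [h]⟩

lemma IsTest.integral_right {Z : Type*} [MeasurableSpace Z] {φ : Y × Z → ℝ} (h : IsTest φ)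
    (ν : Measure Z) [IsProbabilityMeasure ν] : IsTest fun y => ∫ z, φ (y, z) ∂ν :=
  ⟨(h.1.stronglyMeasurable.integral_prod_right').measurable,
    fun y => (h.comp (measurable_prodMk_left (x := y))).integral_mem ν⟩

lemma IsTest.mul_const {φ : Y → ℝ} (h : IsTest φ) {c : ℝ} (hc : c ∈ Icc (0 : ℝ) 1) :
    IsTest fun y => φ y * c :=
  ⟨h.1.mul_const c, fun y => ⟨mul_nonneg (h.2 y).1 hc.1, mul_le_one₀ (h.2 y).2 hc.1 hc.2⟩⟩

lemma bddBelow_tradeoff (P Q : Measure Y) [IsProbabilityMeasure Q] (α : ℝ) :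
    BddBelow {β : ℝ | ∃ φ : Y → ℝ, Measurable φ ∧ (∀ y, φ y ∈ Icc (0 : ℝ) 1) ∧
    ∫ y, φ y ∂P = α ∧ β = 1 - ∫ y, φ y ∂Q} := by
  refine ⟨0, ?_⟩
  rintro _ ⟨φ, h1, h2, -, rfl⟩
  have : IsTest φ := ⟨h1, h2⟩
  linarith [(this.integral_mem Q).2]

lemma tradeoff_le {P Q : Measure Y} [IsProbabilityMeasure Q] {φ : Y → ℝ} (h : IsTest φ) : tradeoff P Q (∫ y, φ y ∂P) ≤ 1 - ∫ y, φ y ∂Q :=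
  csInf_le (bddBelow_tradeoff P Q _) ⟨φ, h.1, h.2, rfl, rfl⟩

lemma le_tradeoff {P Q : Measure Y} [IsProbabilityMeasure P] {α : ℝ} (hα : α ∈ Icc (0 : ℝ) 1) {β : ℝ}
    (h : ∀ φ : Y → ℝ, IsTest φ → ∫ y, φ y ∂P = α → β ≤ 1 - ∫ y, φ y ∂Q) :
    β ≤ tradeoff P Q α := by
  refine le_csInf ⟨_, fun _ => α, measurable_const, fun _ => hα, by simp, rfl⟩ ?_
  rintro _ ⟨φ, h1, h2, h3, rfl⟩
  exact h φ ⟨h1, h2⟩ h3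

variable {P Q : Measure Y} [IsProbabilityMeasure P] [IsProbabilityMeasure Q] {α : ℝ}

lemma tradeoff_nonneg (hα : α ∈ Icc (0 : ℝ) 1) : 0 ≤ tradeoff P Q α :=
  le_tradeoff hα fun φ h _ => by linarith [(h.integral_mem Q).2]

lemma tradeoff_le_one_sub (hα : α ∈ Icc (0 : ℝ) 1) : tradeoff P Q α ≤ 1 - α := by
  simpa using tradeoff_le (P := P) (Q := Q) (isTest_const (Y := Y) hα)

/-- Deterministic post-processing does not help to distinguish two laws. -/
lemma tradeoff_le_map {Z : Type*} [MeasurableSpace Z] {T : Y → Z} (hT : Measurable T)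
    (hα : α ∈ Icc (0 : ℝ) 1) : tradeoff P Q α ≤ tradeoff (P.map T) (Q.map T) α := by
  have := Measure.isProbabilityMeasure_map (μ := P) hT.aemeasurable
  refine le_tradeoff hα fun φ h hφ => ?_
  rw [integral_map hT.aemeasurable h.1.aestronglyMeasurable] at hφ ⊢
  rw [← hφ]
  exact tradeoff_le (h.comp hT)

/-- Post-processing that can be undone preserves the trade-off. -/
lemma tradeoff_map_of_leftInverse {Z : Type*} [MeasurableSpace Z] {T : Y → Z} {T' : Z → Y}
    (hT : Measurable T) (hT' : Measurable T') (h : Function.LeftInverse T' T)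
    (hα : α ∈ Icc (0 : ℝ) 1) : tradeoff (P.map T) (Q.map T) α = tradeoff P Q α := by
  have := Measure.isProbabilityMeasure_map (μ := P) hT.aemeasurable
  have := Measure.isProbabilityMeasure_map (μ := Q) hT.aemeasurable
  refine le_antisymm ?_ (tradeoff_le_map hT hα)
  have h1 := tradeoff_le_map (P := P.map T) (Q := Q.map T) hT' hα
  rwa [Measure.map_map hT' hT, Measure.map_map hT' hT, h.comp_eq_id, Measure.map_id,
    Measure.map_id] at h1

/-- Independent additive noise does not help to distinguish two laws. -/
lemma tradeoff_le_conv {E : Type*} [AddMonoid E] [MeasurableSpace E] [MeasurableAdd₂ E]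
    {P Q : Measure E} [IsProbabilityMeasure P] [IsProbabilityMeasure Q]
    (ν : Measure E) [IsProbabilityMeasure ν] (hα : α ∈ Icc (0 : ℝ) 1) :
    tradeoff P Q α ≤ tradeoff (P.conv ν) (Q.conv ν) α := by
  refine le_tradeoff hα fun φ h hφ => ?_
  rw [integral_conv (h.integrable _)] at hφ ⊢
  rw [← hφ]
  exact tradeoff_le ((h.comp measurable_add).integral_right ν)

/-- The trade-off function is non-increasing in the level. -/
lemma tradeoff_antitone : AntitoneOn (tradeoff P Q) (Icc 0 1) := by
  intro a ha b hb hab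
  refine le_tradeoff ha fun φ h hφ => ?_
  rcases eq_or_lt_of_le hab with rfl | hlt
  · rw [← hφ]; exact tradeoff_le h
  -- mix the test with the trivial test that always rejects
  have ha1 : 0 < 1 - a := by linarith [hb.2]
  set c : ℝ := (b - a) / (1 - a) with hc
  have hc0 : 0 ≤ c := div_nonneg (by linarith) ha1.le
  have hc1 : c ≤ 1 := (div_le_one ha1).2 (by linarith [hb.2])
  have hψ : IsTest fun y => φ y * (1 - c) + c :=
    ⟨(h.1.mul_const _).add_const _, fun y => ⟨by nlinarith [(h.2 y).1], by nlinarith [(h.2 y).2]⟩⟩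
  have e (ν : Measure Y) [IsProbabilityMeasure ν] :
      ∫ y, (φ y * (1 - c) + c) ∂ν = (∫ y, φ y ∂ν) * (1 - c) + c := by
    rw [integral_add ((h.integrable ν).mul_const _) (integrable_const _), integral_mul_const]
    simp
  have h1 := tradeoff_le (P := P) (Q := Q) hψ
  rw [e P, e Q, hφ] at h1
  have h2 : a * (1 - c) + c = b := by rw [hc]; field_simp; ring
  rw [h2] at h1
  nlinarith [(h.integral_mem Q).2]

/-- A convex combination of tests has the same convex combination of levels and powers. The infimum
need not be attained, hence near-optimal tests and a slack `ε`. -/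
lemma tradeoff_convexOn : ConvexOn ℝ (Icc 0 1) (tradeoff P Q) := by
  refine ⟨convex_Icc 0 1, fun x hx y hy a b ha hb hab => ?_⟩
  simp only [smul_eq_mul]
  refine le_of_forall_pos_le_add fun ε hε => ?_
  have key (x : ℝ) (hx : x ∈ Icc (0 : ℝ) 1) :
      ∃ φ : Y → ℝ, IsTest φ ∧ ∫ y, φ y ∂P = x ∧ 1 - ∫ y, φ y ∂Q < tradeoff P Q x + ε := by
    have hne : {β : ℝ | ∃ φ : Y → ℝ, Measurable φ ∧ (∀ y, φ y ∈ Icc (0 : ℝ) 1) ∧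
        ∫ y, φ y ∂P = x ∧ β = 1 - ∫ y, φ y ∂Q}.Nonempty :=
      ⟨_, fun _ => x, measurable_const, fun _ => hx, by simp, rfl⟩
    obtain ⟨_, ⟨φ, h1, h2, h3, rfl⟩, h4⟩ := exists_lt_of_csInf_lt hne (lt_add_of_pos_right _ hε)
    exact ⟨φ, ⟨h1, h2⟩, h3, h4⟩
  obtain ⟨φ, h1, h2, h3⟩ := key x hx
  obtain ⟨ψ, k1, k2, k3⟩ := key y hy
  have ht : IsTest fun z => a * φ z + b * ψ z := by
    refine ⟨(h1.1.const_mul _).add (k1.1.const_mul _), fun z => ⟨?_, ?_⟩⟩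
    · exact add_nonneg (mul_nonneg ha (h1.2 z).1) (mul_nonneg hb (k1.2 z).1)
    · nlinarith [(h1.2 z).2, (k1.2 z).2]
  have e (ν : Measure Y) [IsProbabilityMeasure ν] :
      ∫ z, (a * φ z + b * ψ z) ∂ν = a * (∫ z, φ z ∂ν) + b * ∫ z, ψ z ∂ν := by
    rw [integral_add ((h1.integrable ν).const_mul _) ((k1.integrable ν).const_mul _),
      integral_const_mul, integral_const_mul]
  have := tradeoff_le (P := P) (Q := Q) ht
  rw [e P, e Q, h2, k2] at this
  have h5 := mul_le_mul_of_nonneg_left h3.le ha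
  have h6 := mul_le_mul_of_nonneg_left k3.le hb
  have h7 : a * ε + b * ε = ε := by rw [← add_mul, hab, one_mul]
  linarith

/-- If the alternative is dominated by `L` times the null, the trade-off is `L`-Lipschitz. -/
lemma tradeoff_sub_le {L : ℝ} (hL : ∀ φ : Y → ℝ, IsTest φ → ∫ y, φ y ∂Q ≤ L * ∫ y, φ y ∂P)
    {a b : ℝ} (ha : 0 ≤ a) (hab : a ≤ b) (hb : b ≤ 1) :
    tradeoff P Q a - L * (b - a) ≤ tradeoff P Q b := by
  refine le_tradeoff ⟨ha.trans hab, hb⟩ fun φ h hφ => ?_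
  rcases eq_or_lt_of_le (ha.trans hab) with h0 | h0
  · obtain rfl : a = b := by linarith
    rw [← hφ]; simpa using tradeoff_le (P := P) (Q := Q) h
  -- Shrinking `φ` by `a / b` gives a test of level `a`; the discarded part has level `b - a`, hence
  -- power at most `L * (b - a)`.
  have hc : a / b ∈ Icc (0 : ℝ) 1 := ⟨by positivity, (div_le_one h0).2 hab⟩
  have hc' : 1 - a / b ∈ Icc (0 : ℝ) 1 := ⟨by linarith [hc.2], by linarith [hc.1]⟩
  have h1 := tradeoff_le (P := P) (Q := Q) (h.mul_const hc)
  have h2 := hL _ (h.mul_const hc')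
  simp only [integral_mul_const, hφ] at h1 h2
  rw [mul_div_cancel₀ _ h0.ne'] at h1
  have h3 : b * (1 - a / b) = b - a := by field_simp
  rw [h3] at h2
  linarith

/-- Only continuity needs the domination hypothesis: a trade-off between singular laws may jump at
`0`. -/
lemma isTradeoff_tradeoff {L : ℝ}
    (hL : ∀ φ : Y → ℝ, IsTest φ → ∫ y, φ y ∂Q ≤ L * ∫ y, φ y ∂P) :
    IsTradeoff (tradeoff P Q) ∧ ContinuousOn (tradeoff P Q) (Icc 0 1) := by
  have hL0 : 0 ≤ L := by
    have := hL _ (isTest_const (Y := Y) (right_mem_Icc.2 zero_le_one))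
    simp at this; linarith
  have hc : ContinuousOn (tradeoff P Q) (Icc 0 1) := by
    refine LipschitzOnWith.continuousOn (K := ⟨L, hL0⟩) (LipschitzOnWith.of_dist_le_mul ?_)
    have key (a b : ℝ) (ha : a ∈ Icc (0 : ℝ) 1) (hb : b ∈ Icc (0 : ℝ) 1) (hab : a ≤ b) :
        |tradeoff P Q a - tradeoff P Q b| ≤ L * |a - b| := by
      rw [abs_of_nonneg (by linarith [tradeoff_antitone (P := P) (Q := Q) ha hb hab]),
        abs_sub_comm, abs_of_nonneg (by linarith)]
      linarith [tradeoff_sub_le hL ha.1 hab hb.2]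
    intro a ha b hb
    simp only [Real.dist_eq]
    rcases le_total a b with h | h
    · exact key a b ha hb h
    · rw [abs_sub_comm, abs_sub_comm a b]; exact key b a hb ha h
  exact ⟨⟨fun a ha => ⟨tradeoff_nonneg ha, by linarith [tradeoff_le_one_sub (P := P) (Q := Q) ha,
    ha.1]⟩, tradeoff_convexOn, hc 0 (by simp), tradeoff_antitone,
    fun r hr => tradeoff_le_one_sub hr⟩, hc⟩

/-- **Neyman–Pearson lemma** for a non-randomized likelihood ratio test. -/
lemma tradeoff_eq_of_likelihood_ratio {P Q : Measure Y} [IsProbabilityMeasure P]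
    [IsProbabilityMeasure Q] {l : Y → ℝ} (hl : Measurable l) (hl0 : ∀ y, 0 ≤ l y)
    (hQ : Q = P.withDensity fun y => ENNReal.ofReal (l y)) {s : Set Y} (hs : MeasurableSet s)
    {k : ℝ} (hk : ∀ y ∈ s, k ≤ l y) (hk' : ∀ y ∉ s, l y ≤ k) :
    tradeoff P Q (P.real s) = 1 - Q.real s := by
  have hint (φ : Y → ℝ) : ∫ y, φ y ∂Q = ∫ y, l y * φ y ∂P := by
    rw [hQ, integral_withDensity_eq_integral_toReal_smul hl.ennreal_ofReal (by simp)]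
    simp [ENNReal.toReal_ofReal (hl0 _)]
  have hint' {φ : Y → ℝ} (h : IsTest φ) : Integrable (fun y => l y * φ y) P := by
    have := h.integrable Q
    rw [hQ, integrable_withDensity_iff_integrable_smul' hl.ennreal_ofReal (by simp)] at this
    simpa [ENNReal.toReal_ofReal (hl0 _)] using this
  have hi := isTest_indicator hs
  have eP : ∫ y, s.indicator (fun _ => (1 : ℝ)) y ∂P = P.real s := by
    rw [integral_indicator hs]; simp
  have eQ : ∫ y, s.indicator (fun _ => (1 : ℝ)) y ∂Q = Q.real s := by
    rw [integral_indicator hs]; simp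
  refine le_antisymm ?_ (le_tradeoff ⟨measureReal_nonneg, measureReal_le_one⟩ fun φ h hφ => ?_)
  · have := tradeoff_le (P := P) (Q := Q) hi
    rwa [eP, eQ] at this
  · rw [← eQ, hint, hint]
    rw [← eP] at hφ
    -- Both factors have the same sign at every point, since `φ` takes values in `[0, 1]`. The term
    -- with `k` drops out because the levels agree.
    have h0 : 0 ≤ ∫ y, (l y - k) * (s.indicator (fun _ => (1 : ℝ)) y - φ y) ∂P := by
      refine integral_nonneg fun y => ?_
      by_cases hy : y ∈ s
      · simpa [hy] using mul_nonneg (sub_nonneg.2 (hk y hy)) (sub_nonneg.2 (h.2 y).2)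
      · simpa [hy] using mul_nonpos_of_nonpos_of_nonneg (sub_nonpos.2 (hk' y hy)) (h.2 y).1
    have e : (fun y => (l y - k) * (s.indicator (fun _ => (1 : ℝ)) y - φ y)) = fun y =>
        (l y * s.indicator (fun _ => (1 : ℝ)) y - l y * φ y)
          - k * (s.indicator (fun _ => (1 : ℝ)) y - φ y) := by ext y; ring
    have i1 : Integrable (fun y => l y * s.indicator (fun _ => (1 : ℝ)) y - l y * φ y) P :=
      (hint' hi).sub (hint' h)
    have i2 : Integrable (fun y => k * (s.indicator (fun _ => (1 : ℝ)) y - φ y)) P :=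
      ((hi.integrable P).sub (h.integrable P)).const_mul k
    rw [e, integral_sub i1 i2, integral_sub (hint' hi) (hint' h), integral_const_mul,
      integral_sub (hi.integrable P) (h.integrable P), hφ] at h0
    linarith

/-- Perturbation of the two laws in total variation. -/
lemma sub_le_tradeoff_of_approx {P' Q' : Measure Y} [IsProbabilityMeasure P']
    {f : ℝ → ℝ} {L ε : ℝ}
    (hf : ∀ a ∈ Icc (0 : ℝ) 1, ∀ b ∈ Icc (0 : ℝ) 1, f a - L * |b - a| ≤ f b) (hL : 0 ≤ L)
    (hPQ : ∀ a ∈ Icc (0 : ℝ) 1, f a ≤ tradeoff P Q a)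
    (hP : ∀ φ : Y → ℝ, IsTest φ → |∫ y, φ y ∂P - ∫ y, φ y ∂P'| ≤ ε)
    (hQ : ∀ φ : Y → ℝ, IsTest φ → |∫ y, φ y ∂Q - ∫ y, φ y ∂Q'| ≤ ε) (hα : α ∈ Icc (0 : ℝ) 1) :
    f α - (L + 1) * ε ≤ tradeoff P' Q' α := by
  refine le_tradeoff hα fun φ h hφ => ?_
  -- Under `P` the level of `φ` is off by at most `ε`, which costs `L * ε` in `f`; the change of
  -- power costs another `ε`.
  have h1 := hP φ h
  have h2 := abs_le.1 (hQ φ h)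
  have h3 := hf α hα _ (h.integral_mem P)
  have h4 := (hPQ _ (h.integral_mem P)).trans (tradeoff_le h)
  rw [hφ] at h1
  have h5 := mul_le_mul_of_nonneg_left h1 hL
  linarith [h2.1, h2.2]

end Tradeoff

lemma IsTradeoff.max_sub {f : ℝ → ℝ} (hf : IsTradeoff f) {b : ℝ} (hb : 0 ≤ b) :
    IsTradeoff fun α => max 0 (f α - b) where
  mapsTo x hx := ⟨le_max_left _ _, max_le zero_le_one (by linarith [(hf.mapsTo hx).2])⟩
  convex := by
    have h : ConvexOn ℝ (Icc 0 1) fun α => f α - b := by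
      simp only [sub_eq_add_neg]
      exact hf.convex.add_const (-b)
    exact (convexOn_const 0 (convex_Icc 0 1)).sup h
  continuous_zero := (continuousWithinAt_const).max (hf.continuous_zero.sub
    continuousWithinAt_const)
  antitone x hx y hy h := max_le_max le_rfl (by linarith [hf.antitone hx hy h])
  le_one_sub r hr := max_le (by linarith [hr.2]) (by linarith [hf.le_one_sub r hr])

lemma isTradeoff_congr {f h : ℝ → ℝ} (hf : IsTradeoff f) (e : EqOn h f (Icc 0 1)) :
    IsTradeoff h where
  mapsTo x hx := by rw [e hx]; exact hf.mapsTo hx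
  convex := hf.convex.congr e.symm
  continuous_zero := hf.continuous_zero.congr (fun x hx => e hx) (e (by simp))
  antitone := hf.antitone.congr e.symm
  le_one_sub r hr := by rw [e hr]; exact hf.le_one_sub r hr

/-- A continuous trade-off function that bounds the trade-offs of almost all test points from below
yields membership inference privacy, by Jensen's inequality. -/
lemma isMIP_of_forall_le {X Y : Type*} [MeasurableSpace X] [MeasurableSpace Y] {D : Measure X}
    [IsProbabilityMeasure D] {A₀ : Measure Y} [IsProbabilityMeasure A₀] {A₁ : X → Measure Y}
    [∀ x, IsProbabilityMeasure (A₁ x)]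
    {f : ℝ → ℝ} (hf : IsTradeoff f) (hfc : ContinuousOn f (Icc 0 1))
    (h : ∀ᵐ x' ∂D, ∀ a ∈ Icc (0 : ℝ) 1, f a ≤ tradeoff A₀ (A₁ x') a) : IsMIP D A₀ A₁ f := by
  refine ⟨hf, fun α hα => le_csInf ⟨_, fun _ => α, measurable_const, fun _ => hα, by simp, rfl⟩ ?_⟩
  rintro _ ⟨a, ham, ha, hαa, rfl⟩
  have hat : IsTest a := ⟨ham, ha⟩
  have hm : Measurable fun x => f (a x) := by
    have h1 : Measurable ((Icc (0 : ℝ) 1).domRestrict f) :=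
      (continuousOn_iff_continuous_domRestrict.1 hfc).measurable
    exact h1.comp (ham.subtype_mk (h := ha))
  have hft : IsTest fun x => f (a x) := ⟨hm, fun x => hf.mapsTo (ha x)⟩
  calc f α ≤ ∫ x, f (a x) ∂D := by
        rw [← hαa]
        exact hf.convex.map_integral_le hfc isClosed_Icc (.of_forall ha) (hat.integrable D)
          (hft.integrable D)
    _ = (∫⁻ x, ENNReal.ofReal (f (a x)) ∂D).toReal :=
        integral_eq_lintegral_of_nonneg_ae (.of_forall fun x => (hft.2 x).1)
          hm.aestronglyMeasurable
    _ ≤ _ := by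
        -- The trade-off at `a x` need not be measurable in `x`, so only monotonicity of the lower
        -- integral is used. Finiteness is needed because `toReal` sends `∞` to `0`.
        refine ENNReal.toReal_mono ?_ (lintegral_mono_ae ?_)
        · refine ne_top_of_le_ne_top (b := ∫⁻ _, 1 ∂D) (by simp) (lintegral_mono fun x => ?_)
          refine ENNReal.ofReal_le_one.2 ?_
          linarith [tradeoff_le_one_sub (P := A₀) (Q := A₁ x) (ha x), (ha x).1]
        · filter_upwards [h] with x hx
          exact ENNReal.ofReal_le_ofReal (hx _ (ha x))

/-! ### Isotropic Gaussian laws and their likelihood ratios -/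

section IsoGauss

variable {E : Type*} [NormedAddCommGroup E] [InnerProductSpace ℝ E]
  [MeasurableSpace E]

/-- The likelihood ratio of `N(m', s'² I)` with respect to `N(m, s² I)`. -/
noncomputable def isoGaussRatio (m : E) (s : ℝ) (m' : E) (s' : ℝ) (x : E) : ℝ :=
  (s / s') ^ Module.finrank ℝ E *
    Real.exp (‖x - m‖ ^ 2 / (2 * s ^ 2) - ‖x - m'‖ ^ 2 / (2 * s' ^ 2))

lemma measurable_isoGaussRatio [BorelSpace E] (m : E) (s : ℝ) (m' : E) (s' : ℝ) :
    Measurable (isoGaussRatio m s m' s') := by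
  unfold isoGaussRatio; fun_prop

variable [FiniteDimensional ℝ E]

/-- The Gaussian law `N(m, s² I)`. -/
noncomputable def isoGauss (m : E) (s : ℝ) : Measure E :=
  (stdGaussian E).map fun u => m + s • u

lemma isoGauss_zero_one : isoGauss (0 : E) 1 = stdGaussian E := by
  simp [isoGauss]

variable [BorelSpace E]

instance (m : E) (s : ℝ) : IsProbabilityMeasure (isoGauss m s) :=
  Measure.isProbabilityMeasure_map (by fun_prop)

/-- The two measures have the same characteristic function. The normalizing constant stays implicit
because it cancels in likelihood ratios. -/
lemma stdGaussian_eq_withDensity : ∃ c : ℝ, 0 < c ∧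
    stdGaussian E = volume.withDensity fun x => ENNReal.ofReal (c * Real.exp (-‖x‖ ^ 2 / 2)) := by
  set n := Module.finrank ℝ E
  have h2 : (0 : ℝ) < ((1 / 2 : ℝ) : ℂ).re := by norm_num
  set c : ℝ := ((2 * Real.pi) ^ ((n : ℝ) / 2))⁻¹ with hc
  have hcpos : 0 < c := by positivity
  have hint : Integrable fun x : E => c * Real.exp (-‖x‖ ^ 2 / 2) := by
    have := (GaussianFourier.integrable_cexp_neg_mul_sq_norm_add (V := E) h2 0 0).norm
    refine (this.congr (.of_forall fun x => ?_)).const_mul c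
    simp only [Complex.norm_exp]
    congr 1
    have : (-((1 / 2 : ℝ) : ℂ) * (‖x‖ : ℂ) ^ 2 + 0 * (inner ℝ (0 : E) x : ℝ)) =
      ((-‖x‖ ^ 2 / 2 : ℝ) : ℂ) := by push_cast; ring
    rw [this, Complex.ofReal_re]
  refine ⟨c, hcpos, ?_⟩
  have : IsFiniteMeasure
      (volume.withDensity fun x : E => ENNReal.ofReal (c * Real.exp (-‖x‖ ^ 2 / 2))) :=
    isFiniteMeasure_withDensity_ofReal hint.2
  refine Measure.ext_of_charFun ?_
  ext t
  rw [charFun_stdGaussian, charFun_apply,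
    integral_withDensity_eq_integral_toReal_smul (by fun_prop) (by simp)]
  have e : (fun x : E => (ENNReal.ofReal (c * Real.exp (-‖x‖ ^ 2 / 2))).toReal •
      Complex.exp ((inner ℝ x t : ℝ) * Complex.I)) = fun x : E => (c : ℂ) *
      Complex.exp (-((1 / 2 : ℝ) : ℂ) * (‖x‖ : ℂ) ^ 2 + Complex.I * (inner ℝ t x : ℝ)) := by
    ext x
    rw [ENNReal.toReal_ofReal (by positivity), Complex.real_smul, Complex.ofReal_mul,
      Complex.ofReal_exp, mul_assoc, ← Complex.exp_add, real_inner_comm]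
    congr 2
    push_cast; ring
  rw [e, integral_const_mul, GaussianFourier.integral_cexp_neg_mul_sq_norm_add h2]
  have e1 : ((Real.pi : ℂ) / ((1 / 2 : ℝ) : ℂ)) ^ ((n : ℂ) / 2) =
      (((2 * Real.pi) ^ ((n : ℝ) / 2) : ℝ) : ℂ) := by
    rw [Complex.ofReal_cpow (by positivity)]
    congr 1 <;> push_cast <;> ring
  rw [e1, ← mul_assoc, ← Complex.ofReal_mul, hc, inv_mul_cancel₀ (by positivity),
    Complex.ofReal_one, one_mul]
  congr 1
  rw [Complex.I_sq]; push_cast; ring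

lemma lintegral_comp_add_smul (m : E) {s : ℝ} (hs : 0 < s) {f : E → ℝ≥0∞} (hf : Measurable f) :
    ∫⁻ u, f (m + s • u) = ENNReal.ofReal ((s ^ Module.finrank ℝ E)⁻¹) * ∫⁻ x, f x := by
  have h : (volume : Measure E).map (fun u => m + s • u) =
      ENNReal.ofReal ((s ^ Module.finrank ℝ E)⁻¹) • volume := by
    rw [show (fun u : E => m + s • u) = (fun y => m + y) ∘ (s • ·) from rfl,
      ← Measure.map_map (by fun_prop) (by fun_prop), Measure.map_addHaar_smul _ hs.ne',
      Measure.map_smul, map_add_left_eq_self, abs_of_nonneg (by positivity)]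
  rw [← lintegral_map hf (by fun_prop), h, lintegral_smul_measure, smul_eq_mul]

/-- Change of variables. The constant `c` is chosen before `m` and `s`, so that it cancels between
two such densities. -/
lemma isoGauss_eq_withDensity : ∃ c : ℝ, 0 < c ∧ ∀ (m : E) (s : ℝ), 0 < s →
    isoGauss m s = volume.withDensity fun x =>
      ENNReal.ofReal (c * (s ^ Module.finrank ℝ E)⁻¹ *
        Real.exp (-‖x - m‖ ^ 2 / (2 * s ^ 2))) := by
  obtain ⟨c, hc, h⟩ := stdGaussian_eq_withDensity (E := E)
  refine ⟨c, hc, fun m s hs => ?_⟩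
  ext B hB
  have hT : Measurable fun u : E => m + s • u := by fun_prop
  rw [isoGauss, Measure.map_apply hT hB, h, withDensity_apply _ (hT hB), withDensity_apply _ hB,
    ← lintegral_indicator (hT hB), ← lintegral_indicator hB]
  have hm : Measurable (B.indicator fun x => ENNReal.ofReal (c *
      Real.exp (-‖x - m‖ ^ 2 / (2 * s ^ 2)))) := by
    refine Measurable.indicator ?_ hB
    fun_prop
  have key := lintegral_comp_add_smul m hs hm
  rw [← lintegral_const_mul _ hm] at key
  convert! key using 2
  · ext u
    by_cases hu : m + s • u ∈ B
    · rw [indicator_of_mem (by exact hu), indicator_of_mem hu]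
      congr 3
      rw [add_sub_cancel_left, norm_smul, mul_pow, Real.norm_eq_abs, sq_abs]
      field_simp
    · rw [indicator_of_notMem (by exact hu), indicator_of_notMem hu]
  · ext x
    by_cases hx : x ∈ B
    · rw [indicator_of_mem hx, indicator_of_mem hx, ← ENNReal.ofReal_mul (by positivity)]
      congr 1; ring
    · simp [hx]

lemma isoGauss_eq_withDensity_ratio (m : E) {s : ℝ} (hs : 0 < s) (m' : E) {s' : ℝ}
    (hs' : 0 < s') :
    isoGauss m' s' = (isoGauss m s).withDensity fun x =>
      ENNReal.ofReal (isoGaussRatio m s m' s' x) := by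
  obtain ⟨c, hc, h⟩ := isoGauss_eq_withDensity (E := E)
  rw [h m s hs, h m' s' hs', ← withDensity_mul _ (by fun_prop)
    (measurable_isoGaussRatio ..).ennreal_ofReal]
  congr 1
  ext x
  rw [Pi.mul_apply, ← ENNReal.ofReal_mul (by positivity), isoGaussRatio]
  congr 1
  have e : Real.exp (-‖x - m'‖ ^ 2 / (2 * s' ^ 2)) = Real.exp (-‖x - m‖ ^ 2 / (2 * s ^ 2)) *
      Real.exp (‖x - m‖ ^ 2 / (2 * s ^ 2) - ‖x - m'‖ ^ 2 / (2 * s' ^ 2)) := by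
    rw [← Real.exp_add]; congr 1; ring
  rw [e, div_pow]
  field_simp

/-- **Cameron–Martin formula** for the standard Gaussian law. -/
lemma isoGauss_one_eq_withDensity (a : E) :
    isoGauss a 1 = (stdGaussian E).withDensity fun u =>
      ENNReal.ofReal (Real.exp (inner ℝ u a - ‖a‖ ^ 2 / 2)) := by
  rw [← isoGauss_zero_one, isoGauss_eq_withDensity_ratio 0 one_pos a one_pos]
  congr 1; ext x
  rw [isoGaussRatio, sub_zero, norm_sub_sq_real]
  simp only [div_one, one_pow, mul_one, one_mul]
  congr 2; ring

lemma isoGauss_absolutelyContinuous (m : E) {s : ℝ} (hs : 0 < s) :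
    isoGauss m s ≪ volume := by
  obtain ⟨c, hc, h⟩ := isoGauss_eq_withDensity (E := E)
  rw [h m s hs]
  exact withDensity_absolutelyContinuous _ _

end IsoGauss

/-! ### The non-central chi-squared distribution -/

/-- Dominated convergence: wherever `q ω ≠ x`, the indicator of `q ω ≤ y` is constant for `y` near
`x`. -/
lemma continuous_measureReal_le {Ω : Type*} [MeasurableSpace Ω] {μ : Measure Ω}
    [IsFiniteMeasure μ] {q : Ω → ℝ≥0∞} (hq : Measurable q) (h0 : ∀ x, μ {ω | q ω = x} = 0) :
    Continuous fun x => μ.real {ω | q ω ≤ x} := by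
  have hm (x : ℝ≥0∞) : MeasurableSet {ω | q ω ≤ x} := measurableSet_le hq measurable_const
  have e : (fun x => μ.real {ω | q ω ≤ x}) =
      fun x => ∫ ω, {ω | q ω ≤ x}.indicator (fun _ => (1 : ℝ)) ω ∂μ := by
    ext x; rw [integral_indicator (hm x)]; simp
  rw [e, continuous_iff_continuousAt]
  intro x
  refine continuousAt_of_dominated (bound := fun _ => 1)
    (.of_forall fun y => (measurable_const.indicator (hm y)).aestronglyMeasurable)
    (.of_forall fun y => .of_forall fun ω => ?_) (integrable_const _) ?_
  · by_cases h : q ω ≤ y <;> simp [indicator, h]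
  · have : ∀ᵐ ω ∂μ, q ω ≠ x := by rw [ae_iff]; simpa using h0 x
    filter_upwards [this] with ω hω
    rcases lt_or_gt_of_ne hω with h | h
    · refine (continuousAt_const (y := (1 : ℝ))).congr ?_
      filter_upwards [lt_mem_nhds h] with y hy
      simp [indicator, hy.le]
    · refine (continuousAt_const (y := (0 : ℝ))).congr ?_
      filter_upwards [gt_mem_nhds h] with y hy
      simp [indicator, hy]

section ChiSq

variable {d : ℕ}

local notation:max "𝔼" d:max => EuclideanSpace ℝ (Fin d)

lemma measurable_normSq_add (b : 𝔼 d) : Measurable fun u : 𝔼 d => ENNReal.ofReal (‖u + b‖ ^ 2) := by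
  fun_prop

/-- A reflection exchanges two centres of equal norm and preserves the standard Gaussian law, so the
equal coordinates in the definition may be replaced by any vector of the right norm. -/
lemma ncChiSqCDF_eq (hd : 1 ≤ d) (b : 𝔼 d) (x : ℝ≥0∞) :
    ncChiSqCDF d (‖b‖ ^ 2) x =
      (stdGaussian 𝔼 d).real {u | ENNReal.ofReal (‖u + b‖ ^ 2) ≤ x} := by
  have hd0 : (d : ℝ) ≠ 0 := by positivity
  set b₀ : 𝔼 d := WithLp.toLp 2 fun _ => √(‖b‖ ^ 2 / d) with hb₀
  have hn : ‖b₀‖ = ‖b‖ := by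
    rw [← sq_eq_sq₀ (norm_nonneg _) (norm_nonneg _), EuclideanSpace.real_norm_sq_eq]
    simp only [hb₀]
    rw [Finset.sum_const, Real.sq_sqrt (by positivity)]
    simp; field_simp
  have h1 : ncChiSq d (‖b‖ ^ 2) = (stdGaussian 𝔼 d).map fun u => ‖u + b₀‖ ^ 2 := by
    rw [ncChiSq, ← map_pi_eq_stdGaussian, Measure.map_map (by fun_prop) (by fun_prop)]
    congr 1; ext u
    simp [EuclideanSpace.real_norm_sq_eq, hb₀]
  have hs : MeasurableSet {y : ℝ | ENNReal.ofReal y ≤ x} :=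
    measurableSet_le ENNReal.measurable_ofReal measurable_const
  have hs' : MeasurableSet {u : 𝔼 d | ENNReal.ofReal (‖u + b‖ ^ 2) ≤ x} :=
    measurableSet_le (measurable_normSq_add b) measurable_const
  set T := (Submodule.span ℝ {b₀ - b})ᗮ.reflection
  have hT : T b₀ = b := Submodule.reflection_sub hn
  rw [ncChiSqCDF, h1, map_measureReal_apply (by fun_prop) hs]
  conv_rhs => rw [← stdGaussian_map T, map_measureReal_apply (by fun_prop) hs']
  congr 1; ext u
  simp only [mem_preimage, mem_ofPred_eq]
  rw [← hT, ← map_add, LinearIsometryEquiv.norm_map]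

lemma exists_normSq_eq (hd : 1 ≤ d) {κ : ℝ} (hκ : 0 ≤ κ) : ∃ b : 𝔼 d, ‖b‖ ^ 2 = κ := by
  refine ⟨EuclideanSpace.single ⟨0, hd⟩ √κ, ?_⟩
  simp [Real.sq_sqrt hκ]

lemma stdGaussian_normSq_add_eq (hd : 1 ≤ d) (b : 𝔼 d) (x : ℝ≥0∞) :
    stdGaussian 𝔼 d {u | ENNReal.ofReal (‖u + b‖ ^ 2) = x} = 0 := by
  have : Nonempty (Fin d) := ⟨⟨0, hd⟩⟩
  rw [← isoGauss_zero_one]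
  refine isoGauss_absolutelyContinuous (0 : 𝔼 d) one_pos ?_
  refine measure_mono_null ?_ (Measure.addHaar_sphere volume (-b) √x.toReal)
  rintro u rfl
  rw [mem_sphere_iff_norm, sub_neg_eq_add, ENNReal.toReal_ofReal (by positivity),
    Real.sqrt_sq (norm_nonneg _)]

lemma continuous_ncChiSqCDF (hd : 1 ≤ d) {κ : ℝ} (hκ : 0 ≤ κ) :
    Continuous (ncChiSqCDF d κ) := by
  obtain ⟨b, rfl⟩ := exists_normSq_eq hd hκ
  rw [funext (ncChiSqCDF_eq hd b)]
  exact continuous_measureReal_le (measurable_normSq_add b) (stdGaussian_normSq_add_eq hd b)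

lemma ncChiSqCDF_zero (hd : 1 ≤ d) {κ : ℝ} (hκ : 0 ≤ κ) : ncChiSqCDF d κ 0 = 0 := by
  obtain ⟨b, rfl⟩ := exists_normSq_eq hd hκ
  rw [ncChiSqCDF_eq hd, measureReal_def]
  simp only [nonpos_iff_eq_zero]
  rw [stdGaussian_normSq_add_eq hd, ENNReal.toReal_zero]

lemma ncChiSqCDF_top (hd : 1 ≤ d) {κ : ℝ} (hκ : 0 ≤ κ) : ncChiSqCDF d κ ⊤ = 1 := by
  obtain ⟨b, rfl⟩ := exists_normSq_eq hd hκ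
  rw [ncChiSqCDF_eq hd]
  simp

/-- Continuity makes the quantile an exact right inverse, so that non-randomized ball tests attain
every level. The value `∞` serves level `1`. -/
lemma ncChiSqCDF_quantile (hd : 1 ≤ d) {κ : ℝ} (hκ : 0 ≤ κ) {α : ℝ} (hα : α ∈ Icc (0 : ℝ) 1) :
    ncChiSqCDF d κ (ncChiSqQuantile d κ α) = α := by
  have hc := continuous_ncChiSqCDF hd hκ
  refine le_antisymm ?_ ?_
  · rcases eq_or_ne (ncChiSqQuantile d κ α) 0 with h | h
    · rw [h, ncChiSqCDF_zero hd hκ]; exact hα.1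
    · have hne : (nhdsWithin (ncChiSqQuantile d κ α) (Iio (ncChiSqQuantile d κ α))).NeBot :=
        nhdsLT_neBot_of_exists_lt ⟨0, pos_iff_ne_zero.2 h⟩
      refine le_of_tendsto (hc.continuousWithinAt (s := Iio (ncChiSqQuantile d κ α))) ?_
      filter_upwards [self_mem_nhdsWithin] with y hy
      by_contra! hlt
      exact absurd (sInf_le (show y ∈ {x | α ≤ ncChiSqCDF d κ x} from hlt.le)) (not_le.2 hy)
  · have hcl : IsClosed {x | α ≤ ncChiSqCDF d κ x} := isClosed_le continuous_const hc
    exact hcl.sInf_mem ⟨⊤, by simpa [ncChiSqCDF_top hd hκ] using hα.2⟩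

lemma isoGauss_neg (m : 𝔼 d) (s : ℝ) : isoGauss m (-s) = isoGauss m s := by
  have h := stdGaussian_map (LinearIsometryEquiv.neg ℝ (E := 𝔼 d))
  conv_rhs => rw [isoGauss, ← h, Measure.map_map (by fun_prop) (by fun_prop)]
  rw [isoGauss]
  congr 1; ext u; simp

/-- The distribution function of the squared norm decreases when the centre moves away from the
origin along a ray. -/
lemma stdGaussian_normSq_add_le (b : 𝔼 d) {s : ℝ} (hs : s ∈ Icc (0 : ℝ) 1) (x : ℝ≥0∞) :
    stdGaussian 𝔼 d {u | ENNReal.ofReal (‖u + b‖ ^ 2) ≤ x} ≤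
      stdGaussian 𝔼 d {u | ENNReal.ofReal (‖u + s • b‖ ^ 2) ≤ x} := by
  rcases eq_or_lt_of_le hs.2 with rfl | hs1
  · simp
  set A := {u : 𝔼 d | ENNReal.ofReal (‖u + b‖ ^ 2) ≤ x} with hA
  set B := {u : 𝔼 d | ENNReal.ofReal (‖u + s • b‖ ^ 2) ≤ x} with hB
  have hAm : MeasurableSet A := measurableSet_le (measurable_normSq_add _) measurable_const
  have hBm : MeasurableSet B := measurableSet_le (measurable_normSq_add _) measurable_const
  set a : 𝔼 d := -((1 + s) • b) with ha
  have hT : Measurable fun u : 𝔼 d => a + (-1 : ℝ) • u := by fun_prop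
  -- the point reflection at `a / 2` exchanges the two balls
  have hpre : (fun u : 𝔼 d => a + (-1 : ℝ) • u) ⁻¹' (A \ B) = B \ A := by
    ext u
    have e1 : a + (-1 : ℝ) • u + b = -(u + s • b) := by rw [ha]; module
    have e2 : a + (-1 : ℝ) • u + s • b = -(u + b) := by rw [ha]; module
    simp only [hA, hB, mem_preimage, Set.mem_sdiff, mem_ofPred_eq, e1, e2, norm_neg]
  have hlt (u : 𝔼 d) (hu : u ∈ A \ B) : ‖u + b‖ ^ 2 < ‖u + s • b‖ ^ 2 := by
    have h1 : ENNReal.ofReal (‖u + b‖ ^ 2) ≤ x := hu.1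
    have h2 : x < ENNReal.ofReal (‖u + s • b‖ ^ 2) := not_le.1 hu.2
    exact (ENNReal.ofReal_lt_ofReal_iff_of_nonneg (by positivity)).1 (h1.trans_lt h2)
  have key : stdGaussian 𝔼 d (A \ B) ≤ stdGaussian 𝔼 d (B \ A) := by
    -- By the reflection it suffices that the density of `N(a, I)` is at least `1` on `A \ B`.
    -- Points there are closer to `-b` than to `-(s • b)`, which is exactly nonnegativity of the
    -- Cameron–Martin exponent.
    have h1 : stdGaussian 𝔼 d (B \ A) = isoGauss a 1 (A \ B) := by
      rw [← isoGauss_neg, isoGauss, Measure.map_apply hT (hAm.diff hBm), hpre]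
    rw [h1, isoGauss_one_eq_withDensity, withDensity_apply _ (hAm.diff hBm), ← setLIntegral_one]
    refine setLIntegral_mono (by fun_prop) fun u hu => ?_
    rw [← ENNReal.ofReal_one]
    refine ENNReal.ofReal_le_ofReal (Real.one_le_exp ?_)
    have h2 := hlt u hu
    rw [norm_add_sq_real, norm_add_sq_real, inner_smul_right, norm_smul, mul_pow,
      Real.norm_eq_abs, sq_abs] at h2
    have h3 : (1 - s) * (2 * inner ℝ u b + (1 + s) * ‖b‖ ^ 2) < 0 := by linarith
    have h4 : 2 * inner ℝ u b + (1 + s) * ‖b‖ ^ 2 < 0 := by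
      by_contra! h; linarith [mul_nonneg (sub_nonneg.2 hs.2) h]
    rw [ha, inner_neg_right, inner_smul_right, norm_neg, norm_smul, mul_pow, Real.norm_eq_abs,
      sq_abs]
    have h5 := mul_nonneg_of_nonpos_of_nonpos h4.le (show -(1 + s) ≤ 0 by linarith [hs.1])
    linarith
  rw [← measure_inter_add_sdiff A hBm, ← measure_inter_add_sdiff B hAm, inter_comm B A]
  gcongr

lemma ncChiSqCDF_antitone (hd : 1 ≤ d) {κ K : ℝ} (hκ : 0 ≤ κ) (hK : κ ≤ K) (x : ℝ≥0∞) :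
    ncChiSqCDF d K x ≤ ncChiSqCDF d κ x := by
  obtain ⟨b, rfl⟩ := exists_normSq_eq hd (hκ.trans hK)
  rcases eq_or_ne b 0 with rfl | hb
  · obtain rfl : κ = ‖(0 : 𝔼 d)‖ ^ 2 := le_antisymm hK (by simpa using hκ)
    rfl
  have hb' : 0 < ‖b‖ ^ 2 := by positivity
  have e : κ = ‖√(κ / ‖b‖ ^ 2) • b‖ ^ 2 := by
    rw [norm_smul, mul_pow, Real.norm_eq_abs, sq_abs, Real.sq_sqrt (by positivity)]
    field_simp
  rw [ncChiSqCDF_eq hd, e, ncChiSqCDF_eq hd]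
  refine ENNReal.toReal_mono (measure_ne_top _ _) (stdGaussian_normSq_add_le b ⟨by positivity, ?_⟩ x)
  exact Real.sqrt_le_one.2 ((div_le_one hb').2 hK)

/-! ### The trade-off between two isotropic Gaussian laws -/

/-- The scale `N` of the statistic is kept apart from the variance `v`: one event is evaluated with
`v = N` for the level and `v = N - 1` for the power, and `N / v` becomes the factor in front of the
quantile. -/
lemma isoGauss_real_ball (hd : 1 ≤ d) (m c : 𝔼 d) {v N : ℝ} (hv : 0 < v) (hN : 0 < N) (x : ℝ≥0∞) :
    (isoGauss m √v).real {z | ENNReal.ofReal (‖z - c‖ ^ 2 / N) ≤ x} =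
      ncChiSqCDF d (‖m - c‖ ^ 2 / v) (ENNReal.ofReal (N / v) * x) := by
  have hm : MeasurableSet {z : 𝔼 d | ENNReal.ofReal (‖z - c‖ ^ 2 / N) ≤ x} :=
    measurableSet_le (by fun_prop) measurable_const
  have hv' : 0 < √v := Real.sqrt_pos.2 hv
  have e : ‖m - c‖ ^ 2 / v = ‖(√v)⁻¹ • (m - c)‖ ^ 2 := by
    rw [norm_smul, mul_pow, Real.norm_eq_abs, sq_abs, inv_pow, Real.sq_sqrt hv.le]; field_simp
  rw [e, ncChiSqCDF_eq hd, isoGauss, map_measureReal_apply (by fun_prop) hm]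
  congr 1; ext u
  simp only [mem_preimage, mem_ofPred_eq]
  have e2 : ‖u + (√v)⁻¹ • (m - c)‖ ^ 2 = N / v * (‖m + √v • u - c‖ ^ 2 / N) := by
    have : m + √v • u - c = √v • (u + (√v)⁻¹ • (m - c)) := by
      rw [smul_add, smul_smul, mul_inv_cancel₀ hv'.ne', one_smul]; abel
    rw [this, norm_smul, mul_pow, Real.norm_eq_abs, sq_abs, Real.sq_sqrt hv.le]
    field_simp
  rw [e2, ENNReal.ofReal_mul (by positivity)]
  exact (ENNReal.mul_le_mul_iff_right (ENNReal.ofReal_pos.2 (by positivity)).ne'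
    ENNReal.ofReal_ne_top).symm

/-- Completing the square; superlevel sets of the ratio are balls centred at `N • δ`. -/
lemma isoGaussRatio_eq {N : ℝ} (hN : 1 < N) (δ z : 𝔼 d) :
    isoGaussRatio 0 √N δ √(N - 1) z = (√N / √(N - 1)) ^ d *
      Real.exp (‖δ‖ ^ 2 / 2 - ‖z - N • δ‖ ^ 2 / N / (2 * (N - 1))) := by
  have h1 : N - 1 ≠ 0 := by linarith
  have h2 : N ≠ 0 := by linarith
  rw [isoGaussRatio, finrank_euclideanSpace_fin, Real.sq_sqrt (by linarith),
    Real.sq_sqrt (by linarith), sub_zero, norm_sub_sq_real, norm_sub_sq_real, inner_smul_right,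
    norm_smul, mul_pow, Real.norm_eq_abs, sq_abs]
  congr 2
  field_simp
  ring

lemma tradeoff_isoGauss (hd : 1 ≤ d) {N : ℝ} (hN : 1 < N) (δ : 𝔼 d) {α : ℝ}
    (hα : α ∈ Icc (0 : ℝ) 1) :
    tradeoff (isoGauss (0 : 𝔼 d) √N) (isoGauss δ √(N - 1)) α =
      oneStepTradeoff d N (‖δ‖ ^ 2) α := by
  have hN0 : 0 < N := by linarith
  have hN1 : 0 < N - 1 := by linarith
  set x := ncChiSqQuantile d (N * ‖δ‖ ^ 2) α with hx
  set s := {z : 𝔼 d | ENNReal.ofReal (‖z - N • δ‖ ^ 2 / N) ≤ x} with hs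
  have hsm : MeasurableSet s := measurableSet_le (by fun_prop) measurable_const
  have hP : (isoGauss (0 : 𝔼 d) √N).real s = α := by
    rw [hs, isoGauss_real_ball hd _ _ hN0 hN0, div_self hN0.ne', ENNReal.ofReal_one, one_mul,
      zero_sub, norm_neg, norm_smul, mul_pow, Real.norm_eq_abs, sq_abs]
    rw [show N ^ 2 * ‖δ‖ ^ 2 / N = N * ‖δ‖ ^ 2 by field_simp]
    exact ncChiSqCDF_quantile hd (by positivity) hα
  have hQ : (isoGauss δ √(N - 1)).real s =
      ncChiSqCDF d ((N - 1) * ‖δ‖ ^ 2) (ENNReal.ofReal (N / (N - 1)) * x) := by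
    rw [hs, isoGauss_real_ball hd _ _ hN1 hN0,
      show δ - N • δ = (-(N - 1)) • δ by module, norm_smul, mul_pow, Real.norm_eq_abs, sq_abs]
    congr 1; field_simp
  rw [oneStepTradeoff, ← hQ, ← hP]
  -- The threshold is the likelihood ratio on the boundary sphere. If `x = ⊤` the ball is the whole
  -- space and the lower bound `0` will do.
  set k : ℝ := if x = ⊤ then 0 else (√N / √(N - 1)) ^ d *
      Real.exp (‖δ‖ ^ 2 / 2 - x.toReal / (2 * (N - 1))) with hk
  refine tradeoff_eq_of_likelihood_ratio (k := k) (measurable_isoGaussRatio ..)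
    (fun y => by unfold isoGaussRatio; positivity)
    (isoGauss_eq_withDensity_ratio 0 (Real.sqrt_pos.2 hN0) δ (Real.sqrt_pos.2 hN1)) hsm
    (fun y hy => ?_) (fun y hy => ?_)
  · rw [isoGaussRatio_eq hN, hk]
    split_ifs with h
    · positivity
    · have : ‖y - N • δ‖ ^ 2 / N ≤ x.toReal := (ENNReal.ofReal_le_iff_le_toReal h).1 hy
      gcongr
  · have hy' : x < ENNReal.ofReal (‖y - N • δ‖ ^ 2 / N) := not_le.1 hy
    have h : x ≠ ⊤ := hy'.ne_top
    have : x.toReal ≤ ‖y - N • δ‖ ^ 2 / N :=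
      (ENNReal.lt_ofReal_iff_toReal_lt h).1 hy' |>.le
    rw [isoGaussRatio_eq hN, hk, if_neg h]
    gcongr

/-- The alternative `√K • e` lies at distance `(N - 1) * √κ` from the centre chosen below, as in the
optimal test for `κ`. The null mean `0` lies at distance `(N - 1) * √κ + √K ≥ N * √κ`, which lowers
the level. -/
lemma oneStepTradeoff_antitone (hd : 1 ≤ d) {N : ℝ} (hN : 1 < N) {κ K : ℝ} (hκ : 0 ≤ κ)
    (hK : κ ≤ K) {α : ℝ} (hα : α ∈ Icc (0 : ℝ) 1) :
    oneStepTradeoff d N K α ≤ oneStepTradeoff d N κ α := by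
  have hN0 : 0 < N := by linarith
  have hN1 : 0 < N - 1 := by linarith
  obtain ⟨e, he⟩ := exists_normSq_eq hd zero_le_one
  have hn (t : ℝ) : ‖t • e‖ ^ 2 = t ^ 2 := by
    rw [norm_smul, mul_pow, he, mul_one, Real.norm_eq_abs, sq_abs]
  set x := ncChiSqQuantile d (N * κ) α
  -- a shifted ball has the power of the optimal test for `κ`, and a smaller level
  set c : 𝔼 d := ((N - 1) * √κ + √K) • e
  set s := {z : 𝔼 d | ENNReal.ofReal (‖z - c‖ ^ 2 / N) ≤ x} with hs
  have hsm : MeasurableSet s := measurableSet_le (by fun_prop) measurable_const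
  have hsq : √κ ≤ √K := Real.sqrt_le_sqrt hK
  have hP : (isoGauss (0 : 𝔼 d) √N).real s ≤ α := by
    rw [hs, isoGauss_real_ball hd _ _ hN0 hN0, div_self hN0.ne', ENNReal.ofReal_one, one_mul,
      zero_sub, norm_neg, hn]
    conv_rhs => rw [← ncChiSqCDF_quantile hd (κ := N * κ) (by positivity) hα]
    refine ncChiSqCDF_antitone hd (by positivity) ?_ x
    rw [le_div_iff₀ hN0]
    calc N * κ * N = (N * √κ) ^ 2 := by rw [mul_pow, Real.sq_sqrt hκ]; ring
      _ ≤ _ := by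
        gcongr
        nlinarith
  have hQ : (isoGauss (√K • e) √(N - 1)).real s =
      ncChiSqCDF d ((N - 1) * κ) (ENNReal.ofReal (N / (N - 1)) * x) := by
    rw [hs, isoGauss_real_ball hd _ _ hN1 hN0,
      show √K • e - c = (-((N - 1) * √κ)) • e by simp only [c]; module, hn]
    congr 1
    rw [neg_sq, mul_pow, Real.sq_sqrt hκ]; field_simp
  have hKe : ‖√K • e‖ ^ 2 = K := by rw [hn, Real.sq_sqrt (hκ.trans hK)]
  have h1 := tradeoff_isoGauss hd hN (√K • e) hα
  rw [hKe] at h1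
  rw [← h1, oneStepTradeoff, ← hQ]
  refine (tradeoff_antitone ⟨measureReal_nonneg, measureReal_le_one⟩ hα hP).trans ?_
  have h2 := tradeoff_le (P := isoGauss (0 : 𝔼 d) √N) (Q := isoGauss (√K • e) √(N - 1))
    (isTest_indicator hsm)
  rw [integral_indicator hsm, integral_indicator hsm] at h2
  simpa using h2

/-- After completing the square the exponent is at most `‖δ‖ ^ 2 / 2`, and `N ≥ 2` bounds the
prefactor. The constant does not involve `N`; this is what makes `B` independent of `n`. -/
lemma integral_isoGauss_le {N : ℝ} (hN : 2 ≤ N) (δ : 𝔼 d) {φ : 𝔼 d → ℝ} (h : IsTest φ) :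
    ∫ y, φ y ∂(isoGauss δ √(N - 1)) ≤
      2 ^ d * Real.exp (‖δ‖ ^ 2 / 2) * ∫ y, φ y ∂(isoGauss (0 : 𝔼 d) √N) := by
  have hN0 : 0 < √N := Real.sqrt_pos.2 (by linarith)
  have hN1 : 0 < √(N - 1) := Real.sqrt_pos.2 (by linarith)
  have hm := measurable_isoGaussRatio (0 : 𝔼 d) √N δ √(N - 1)
  have h0 (y : 𝔼 d) : 0 ≤ isoGaussRatio 0 √N δ √(N - 1) y := by unfold isoGaussRatio; positivity
  have hi := h.integrable (isoGauss δ √(N - 1))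
  rw [isoGauss_eq_withDensity_ratio 0 hN0 δ hN1] at hi ⊢
  rw [integrable_withDensity_iff_integrable_smul' hm.ennreal_ofReal (by simp)] at hi
  rw [integral_withDensity_eq_integral_toReal_smul hm.ennreal_ofReal (by simp),
    ← integral_const_mul]
  refine integral_mono hi ((h.integrable _).const_mul _) fun y => ?_
  simp only [ENNReal.toReal_ofReal (h0 y), smul_eq_mul]
  refine mul_le_mul_of_nonneg_right ?_ (h.2 y).1
  rw [isoGaussRatio_eq (by linarith)]
  have hr : √N / √(N - 1) ≤ 2 := by
    rw [div_le_iff₀ hN1, Real.sqrt_le_left (by positivity), mul_pow, Real.sq_sqrt (by linarith)]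
    linarith
  have he : ‖y - N • δ‖ ^ 2 / N / (2 * (N - 1)) ≥ 0 := by
    have : 0 < N := by linarith
    have : 0 < N - 1 := by linarith
    positivity
  gcongr
  linarith

/-- The function `β_{N,K}` is a Lipschitz trade-off function. -/
lemma isTradeoff_oneStepTradeoff (hd : 1 ≤ d) {N K : ℝ} (hN : 2 ≤ N) (hK : 0 ≤ K) :
    IsTradeoff (oneStepTradeoff d N K) ∧ ContinuousOn (oneStepTradeoff d N K) (Icc 0 1) ∧
    ∀ a ∈ Icc (0 : ℝ) 1, ∀ b ∈ Icc (0 : ℝ) 1,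
      oneStepTradeoff d N K a - 2 ^ d * Real.exp (K / 2) * |b - a| ≤ oneStepTradeoff d N K b := by
  obtain ⟨δ, rfl⟩ := exists_normSq_eq hd hK
  have e : EqOn (oneStepTradeoff d N (‖δ‖ ^ 2))
      (tradeoff (isoGauss (0 : 𝔼 d) √N) (isoGauss δ √(N - 1))) (Icc 0 1) :=
    fun α hα => (tradeoff_isoGauss hd (by linarith) δ hα).symm
  have h := isTradeoff_tradeoff fun φ hφ => integral_isoGauss_le hN δ hφ
  refine ⟨isTradeoff_congr h.1 e, h.2.congr e, fun a ha b hb => ?_⟩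
  rw [e ha, e hb]
  rcases le_total a b with hab | hab
  · rw [abs_of_nonneg (by linarith)]
    exact tradeoff_sub_le (fun φ hφ => integral_isoGauss_le hN δ hφ) ha.1 hab hb.2
  · have h1 := tradeoff_antitone (P := isoGauss (0 : 𝔼 d) √N) (Q := isoGauss δ √(N - 1)) hb ha hab
    have : 0 ≤ 2 ^ d * Real.exp (‖δ‖ ^ 2 / 2) * |b - a| := by positivity
    linarith

end ChiSq

/-! ### The central limit model -/

section CentralLimit

open Matrix

variable {d : ℕ}

local notation:max "𝔼" d:max => EuclideanSpace ℝ (Fin d)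

lemma multivariateGaussian_conv (m₁ m₂ : 𝔼 d) {S₁ S₂ : Matrix (Fin d) (Fin d) ℝ}
    (h₁ : S₁.PosSemidef) (h₂ : S₂.PosSemidef) :
    (multivariateGaussian m₁ S₁).conv (multivariateGaussian m₂ S₂) =
      multivariateGaussian (m₁ + m₂) (S₁ + S₂) := by
  refine Measure.ext_of_charFun ?_
  ext t
  rw [charFun_conv, charFun_multivariateGaussian h₁, charFun_multivariateGaussian h₂,
    charFun_multivariateGaussian (h₁.add h₂), ← Complex.exp_add, inner_add_right, add_mulVec,
    dotProduct_add]
  congr 1; push_cast; ring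

lemma multivariateGaussian_map_smul_add (c : ℝ) (a m : 𝔼 d) {S : Matrix (Fin d) (Fin d) ℝ}
    (h : S.PosSemidef) :
    (multivariateGaussian m S).map (fun s => c • (a + s)) =
      multivariateGaussian (c • (a + m)) (c ^ 2 • S) := by
  have : IsProbabilityMeasure ((multivariateGaussian m S).map fun s => c • (a + s)) :=
    Measure.isProbabilityMeasure_map (by fun_prop)
  refine Measure.ext_of_charFun ?_
  ext t
  rw [charFun_map_smul_comp (by fun_prop), charFun_map_const_add, charFun_multivariateGaussian h,
    charFun_multivariateGaussian (h.smul (sq_nonneg c)), ← Complex.exp_add]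
  congr 1
  simp only [inner_smul_left, inner_smul_right, inner_add_right, smul_mulVec, dotProduct_smul,
    WithLp.ofLp_smul, mulVec_smul, smul_dotProduct, smul_eq_mul, real_inner_comm t]
  simp
  ring

/-- Whitening: the affine map depends on neither `δ` nor `v`, so one map serves both hypotheses. -/
lemma multivariateGaussian_eq_map_isoGauss (m δ : 𝔼 d) {S : Matrix (Fin d) (Fin d) ℝ}
    (h : S.PosSemidef) (n : ℝ) {v : ℝ} (hv : 0 ≤ v) :
    multivariateGaussian (m + n⁻¹ • toEuclideanCLM (𝕜 := ℝ) (CFC.sqrt S) δ) ((v / n ^ 2) • S) =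
      (isoGauss δ √v).map
        fun z => m + n⁻¹ • toEuclideanCLM (𝕜 := ℝ) (CFC.sqrt S) z := by
  set A := toEuclideanCLM (𝕜 := ℝ) (CFC.sqrt S)
  have h1 := multivariateGaussian_map_smul_add (√v * n⁻¹) 0 0 h
  have h2 := multivariateGaussian_map_smul_add 1 (m + n⁻¹ • A δ) 0
    (h.smul (sq_nonneg (√v * n⁻¹)))
  simp only [add_zero, smul_zero, one_smul, one_pow] at h1 h2
  have e : (√v * n⁻¹) ^ 2 = v / n ^ 2 := by
    rw [mul_pow, Real.sq_sqrt hv, inv_pow, div_eq_mul_inv]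
  rw [e] at h1 h2
  rw [← h2, ← h1, multivariateGaussian, isoGauss, Measure.map_map (by fun_prop) (by fun_prop),
    Measure.map_map (by fun_prop) (by fun_prop), Measure.map_map (by fun_prop) (by fun_prop)]
  congr 1; ext1 u
  simp only [Function.comp_apply, zero_add, map_add, map_smul, A]
  module

/-- The square of `det Σ^(1/2)` is `det Σ > 0`, so the root is invertible. -/
lemma toEuclideanCLM_sqrt_inv {S : Matrix (Fin d) (Fin d) ℝ} (h : S.PosDef) :
    (∀ v, toEuclideanCLM (𝕜 := ℝ) (CFC.sqrt S)⁻¹ (toEuclideanCLM (𝕜 := ℝ) (CFC.sqrt S) v) = v) ∧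
    ∀ v, toEuclideanCLM (𝕜 := ℝ) (CFC.sqrt S) (toEuclideanCLM (𝕜 := ℝ) (CFC.sqrt S)⁻¹ v) = v := by
  have hu : IsUnit (CFC.sqrt S).det := by
    have h1 := congrArg det (CFC.sqrt_mul_sqrt_self S h.posSemidef.nonneg)
    rw [det_mul] at h1
    refine isUnit_iff_ne_zero.2 fun h0 => h.det_pos.ne' ?_
    rw [← h1, h0, zero_mul]
  have key (B B' : Matrix (Fin d) (Fin d) ℝ) (hB : B * B' = 1) (v : 𝔼 d) :
      toEuclideanCLM (𝕜 := ℝ) B (toEuclideanCLM (𝕜 := ℝ) B' v) = v := by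
    have h2 := congrArg (fun L => L v) (map_mul (toEuclideanCLM (n := Fin d) (𝕜 := ℝ)) B B')
    simp only [hB, map_one] at h2
    exact h2.symm
  exact ⟨key _ _ (nonsing_inv_mul _ hu), key _ _ (mul_nonsing_inv _ hu)⟩

variable {X : Type*} [MeasurableSpace X] {D : Measure X} {θ : X → 𝔼 d}

lemma memLp_apply (hL2 : MemLp θ 2 D) (i : Fin d) : MemLp (fun x => θ x i) 2 D :=
  hL2.eval_piLp i

lemma cltNullLaw_eq (hcov : (gradCov D θ).PosSemidef) (m : ℕ) {V : Matrix (Fin d) (Fin d) ℝ}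
    (hV : V.PosSemidef) : cltNullLaw D θ m V =
      multivariateGaussian (gradMean D θ) ((1 / ((m : ℝ) + 1)) • gradCov D θ + V) := by
  have h := multivariateGaussian_map_smul_add (1 / ((m : ℝ) + 1)) 0
    (((m + 1 : ℕ) : ℝ) • gradMean D θ) (hcov.smul (Nat.cast_nonneg (α := ℝ) (m + 1)))
  simp only [zero_add] at h
  rw [cltNullLaw, cltSum, h, multivariateGaussian_conv _ _ _ hV]
  · have : (m : ℝ) + 1 ≠ 0 := by positivity
    rw [add_zero, smul_smul, smul_smul]
    push_cast
    congr 2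
    · rw [one_div_mul_cancel this, one_smul]
    · congr 1; field_simp
  · exact (hcov.smul (Nat.cast_nonneg (α := ℝ) (m + 1))).smul (sq_nonneg _)

lemma cltMemberLaw_eq (hcov : (gradCov D θ).PosSemidef) (m : ℕ) {V : Matrix (Fin d) (Fin d) ℝ}
    (hV : V.PosSemidef) (x : X) : cltMemberLaw D θ m V x =
      multivariateGaussian (gradMean D θ + ((m : ℝ) + 1)⁻¹ • (θ x - gradMean D θ))
        (((m : ℝ) / ((m : ℝ) + 1) ^ 2) • gradCov D θ + V) := by
  have h := multivariateGaussian_map_smul_add (1 / ((m : ℝ) + 1)) (θ x)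
    ((m : ℝ) • gradMean D θ) (hcov.smul (Nat.cast_nonneg (α := ℝ) m))
  rw [cltMemberLaw, cltSum, h, multivariateGaussian_conv _ _ _ hV]
  · have : (m : ℝ) + 1 ≠ 0 := by positivity
    rw [add_zero, smul_smul]
    congr 2
    · rw [one_div]
      have e : gradMean D θ = ((m : ℝ) + 1)⁻¹ • (((m : ℝ) + 1) • gradMean D θ) := by
        rw [smul_smul, inv_mul_cancel₀ this, one_smul]
      conv_rhs => enter [1]; rw [e]
      rw [← smul_add]
      congr 1; module
    · congr 1; field_simp
  · exact (hcov.smul (Nat.cast_nonneg (α := ℝ) m)).smul (sq_nonneg _)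

/-- The optimal trade-off in the central limit model for noise with covariance `q Σ`. -/
lemma tradeoff_clt_eq (hd : 1 ≤ d) (hcov : (gradCov D θ).PosDef) {m : ℕ} (hm : 1 ≤ m) {q : ℝ}
    (hq : 0 ≤ q) (x : X) {α : ℝ} (hα : α ∈ Icc (0 : ℝ) 1) :
    tradeoff (cltNullLaw D θ m (q • gradCov D θ)) (cltMemberLaw D θ m (q • gradCov D θ) x) α =
      oneStepTradeoff d (((m : ℝ) + 1) + q * ((m : ℝ) + 1) ^ 2) (susceptibility D θ x) α := by
  have hps := hcov.posSemidef
  have hm1 : (1 : ℝ) ≤ m := by exact_mod_cast hm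
  set n : ℝ := (m : ℝ) + 1 with hn
  have hn0 : n ≠ 0 := by positivity
  -- Chosen so that `N / n² = 1 / n + q` and `(N - 1) / n² = (n - 1) / n² + q`, the multiples of `Σ`
  -- in the two covariances.
  set N : ℝ := n + q * n ^ 2 with hN
  have hN1 : 1 < N := by
    have : 0 ≤ q * n ^ 2 := by positivity
    linarith
  set A := toEuclideanCLM (𝕜 := ℝ) (CFC.sqrt (gradCov D θ)) with hA
  set A' := toEuclideanCLM (𝕜 := ℝ) (CFC.sqrt (gradCov D θ))⁻¹ with hA'
  obtain ⟨hAA, hAA'⟩ := toEuclideanCLM_sqrt_inv hcov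
  set δ : 𝔼 d := A' (θ x - gradMean D θ) with hδ
  have e0 : cltNullLaw D θ m (q • gradCov D θ) =
      (isoGauss (0 : 𝔼 d) √N).map fun z => gradMean D θ + n⁻¹ • A z := by
    rw [cltNullLaw_eq hps m (hps.smul hq),
      ← multivariateGaussian_eq_map_isoGauss _ _ hps n (by linarith), map_zero, smul_zero, add_zero,
      ← add_smul]
    congr 2; rw [hN]; field_simp; ring
  have e1 : cltMemberLaw D θ m (q • gradCov D θ) x =
      (isoGauss δ √(N - 1)).map fun z => gradMean D θ + n⁻¹ • A z := by
    rw [cltMemberLaw_eq hps m (hps.smul hq),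
      ← multivariateGaussian_eq_map_isoGauss _ _ hps n (by linarith), hδ, hAA', ← add_smul]
    congr 2; rw [hN, ← hn]; field_simp; rw [hn]; ring
  rw [e0, e1, tradeoff_map_of_leftInverse (T' := fun w => n • A' (w - gradMean D θ))
    (by fun_prop) (by fun_prop) (fun z => ?_) hα, tradeoff_isoGauss hd hN1 δ hα]
  · rfl
  · simp only [add_sub_cancel_left]
    rw [map_smul, smul_smul, mul_inv_cancel₀ hn0, one_smul, hAA]

/-- Noise with covariance `V ≥ q Σ` hides at least as much as noise with covariance `q Σ`. -/
lemma oneStepTradeoff_le_tradeoff_clt (hd : 1 ≤ d) (hcov : (gradCov D θ).PosDef) {m : ℕ}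
    (hm : 1 ≤ m) {q : ℝ} (hq : 0 ≤ q) {V : Matrix (Fin d) (Fin d) ℝ}
    (hV : (V - q • gradCov D θ).PosSemidef) {K : ℝ} (x : X) (hK : susceptibility D θ x ≤ K)
    {α : ℝ} (hα : α ∈ Icc (0 : ℝ) 1) :
    oneStepTradeoff d (((m : ℝ) + 1) + q * ((m : ℝ) + 1) ^ 2) K α ≤
      tradeoff (cltNullLaw D θ m V) (cltMemberLaw D θ m V x) α := by
  have hps := hcov.posSemidef
  have hm1 : (1 : ℝ) ≤ m := by exact_mod_cast hm
  have hqS := hps.smul hq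
  have hV' : V.PosSemidef := by simpa using hV.add hqS
  have hN1 : 1 < ((m : ℝ) + 1) + q * ((m : ℝ) + 1) ^ 2 := by
    have : 0 ≤ q * ((m : ℝ) + 1) ^ 2 := by positivity
    linarith
  refine (oneStepTradeoff_antitone hd hN1 (by unfold susceptibility; positivity) hK hα).trans ?_
  rw [← tradeoff_clt_eq hd hcov hm hq x hα, cltNullLaw_eq hps m hqS, cltNullLaw_eq hps m hV',
    cltMemberLaw_eq hps m hqS, cltMemberLaw_eq hps m hV']
  -- Noise of covariance `V` is noise of covariance `q Σ` plus independent noise of covariance `V -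
  -- q Σ`.
  refine (tradeoff_le_conv (multivariateGaussian 0 (V - q • gradCov D θ)) hα).trans_eq ?_
  rw [multivariateGaussian_conv _ _ ((hps.smul (by positivity)).add hqS) hV,
    multivariateGaussian_conv _ _ ((hps.smul (by positivity)).add hqS) hV]
  congr 2 <;> first | rw [add_zero] | abel

variable [IsProbabilityMeasure D]

lemma dotProduct_gradCov (hL2 : MemLp θ 2 D) (v : 𝔼 d) :
    v ⬝ᵥ gradCov D θ *ᵥ v = Var[fun x => inner ℝ v (θ x); D] := by
  have e : (fun x => inner ℝ v (θ x)) = fun x => ∑ i, v i * θ x i := by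
    ext x; simp [PiLp.inner_apply, mul_comm]
  have hm (i : Fin d) : MemLp (fun x => v i * θ x i) 2 D := (memLp_apply hL2 i).const_mul _
  rw [e, ← covariance_self (memLp_finsetSum _ fun i _ => hm i).aemeasurable,
    covariance_fun_sum_fun_sum hm hm]
  simp only [covariance_const_mul_left, covariance_const_mul_right, dotProduct, mulVec, gradCov,
    of_apply, Finset.mul_sum]
  exact Finset.sum_congr rfl fun i _ => Finset.sum_congr rfl fun j _ => by ring

/-- Gradients bounded by `c` have covariance at most `c² I`. -/
lemma posSemidef_sub_gradCov (hL2 : MemLp θ 2 D) (hcov : (gradCov D θ).PosSemidef) {c t q : ℝ}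
    (hc : ∀ x, ‖θ x‖ ≤ c) (hq : 0 ≤ q) (hqc : q * c ^ 2 ≤ t) :
    (t • (1 : Matrix (Fin d) (Fin d) ℝ) - q • gradCov D θ).PosSemidef := by
  refine PosSemidef.of_dotProduct_mulVec_nonneg ?_ fun w => ?_
  · exact (isHermitian_one.smul (IsSelfAdjoint.all t)).sub
      (hcov.isHermitian.smul (IsSelfAdjoint.all q))
  · set v : 𝔼 d := WithLp.toLp 2 w
    have h1 : w ⬝ᵥ gradCov D θ *ᵥ w = Var[fun x => inner ℝ v (θ x); D] := dotProduct_gradCov hL2 v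
    have h2 : w ⬝ᵥ w = ‖v‖ ^ 2 := by
      rw [EuclideanSpace.real_norm_sq_eq]; simp [dotProduct, v, sq]
    rw [star_trivial, sub_mulVec, dotProduct_sub, smul_mulVec, smul_mulVec, dotProduct_smul,
      dotProduct_smul, one_mulVec, h1, h2, smul_eq_mul, smul_eq_mul]
    have hm : AEStronglyMeasurable (fun x => inner ℝ v (θ x)) D := hL2.1.const_inner
    have h3 : Var[fun x => inner ℝ v (θ x); D] ≤ ‖v‖ ^ 2 * c ^ 2 := by
      refine (variance_le_expectation_sq hm).trans ?_
      have hb (x : X) : (inner ℝ v (θ x)) ^ 2 ≤ ‖v‖ ^ 2 * c ^ 2 := by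
        rw [← mul_pow, ← sq_abs]
        gcongr
        exact (abs_real_inner_le_norm _ _).trans (by gcongr; exact hc x)
      calc _ ≤ ∫ _, ‖v‖ ^ 2 * c ^ 2 ∂D := by
            refine integral_mono_of_nonneg (.of_forall fun x => sq_nonneg _) (integrable_const _)
              (.of_forall hb)
        _ = _ := by simp
    have h4 := mul_le_mul_of_nonneg_left h3 hq
    have h5 := mul_le_mul_of_nonneg_left hqc (sq_nonneg ‖v‖)
    linarith

lemma norm_clip_le {C : ℝ≥0∞} (hC : C ≠ ⊤) (v : 𝔼 d) : ‖clip C v‖ ≤ C.toReal := by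
  rw [clip, norm_smul, Real.norm_eq_abs, abs_of_nonneg ENNReal.toReal_nonneg, ← toReal_enorm v,
    ← ENNReal.toReal_mul]
  refine ENNReal.toReal_mono hC ?_
  calc min 1 (C / ‖v‖ₑ) * ‖v‖ₑ ≤ C / ‖v‖ₑ * ‖v‖ₑ := by gcongr; exact min_le_right _ _
    _ ≤ C := by rw [mul_comm]; exact ENNReal.mul_div_le

lemma susceptibility_bound_nonneg {K : ℝ} (hK : ∀ᵐ x ∂D, susceptibility D θ x ≤ K) : 0 ≤ K := by
  obtain ⟨x, hx⟩ := hK.exists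
  exact le_trans (by unfold susceptibility; positivity) hx

/-- The effective batch size belongs to a multiple `q Σ` of the gradient covariance that is
dominated by the noise covariance `τ² I`. -/
lemma exists_nEff_eq {g : X → 𝔼 d} {C : ℝ≥0∞} (hC : C ≠ 0) (τ : ℝ)
    (hθ : θ = fun x => clip C (g x)) (hL2 : MemLp θ 2 D) (hcov : (gradCov D θ).PosDef) :
    ∃ q : ℝ, 0 ≤ q ∧
      (τ ^ 2 • (1 : Matrix (Fin d) (Fin d) ℝ) - q • gradCov D θ).PosSemidef ∧
      ∀ m : ℕ, nEff (m + 1) τ C = ((m : ℝ) + 1) + q * ((m : ℝ) + 1) ^ 2 := by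
  rcases eq_or_ne C ⊤ with rfl | hC'
  · refine ⟨0, le_rfl, ?_, fun m => by simp [nEff]⟩
    rw [zero_smul, sub_zero]
    exact PosSemidef.one.smul (sq_nonneg τ)
  · have h0 : 0 < C.toReal := ENNReal.toReal_pos hC hC'
    refine ⟨τ ^ 2 / C.toReal ^ 2, by positivity, posSemidef_sub_gradCov hL2 hcov.posSemidef
      (c := C.toReal) (fun x => by rw [hθ]; exact norm_clip_le hC' _) (by positivity) ?_,
      fun m => ?_⟩
    · rw [div_mul_cancel₀ _ (by positivity)]
    · rw [nEff, ENNReal.toReal_div, ENNReal.toReal_ofReal (by positivity), ENNReal.toReal_pow]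
      push_cast; ring

end CentralLimit

/-! ### Replacing sums of independent vectors by Gaussian vectors under Gaussian noise -/

/-- Two laws that differ by at most `ε` on every test. -/
def TestClose {Y : Type*} [MeasurableSpace Y] (P Q : Measure Y) (ε : ℝ) : Prop :=
  ∀ φ : Y → ℝ, IsTest φ → |∫ y, φ y ∂P - ∫ y, φ y ∂Q| ≤ ε

namespace TestClose

lemma trans {Y : Type*} [MeasurableSpace Y] {P Q R : Measure Y} {ε η : ℝ}
    (h : TestClose P Q ε) (h' : TestClose Q R η) : TestClose P R (ε + η) := fun φ hφ =>
  (abs_sub_le _ _ _).trans (add_le_add (h φ hφ) (h' φ hφ))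

lemma map {Y Z : Type*} [MeasurableSpace Y] [MeasurableSpace Z] {P Q : Measure Y} {ε : ℝ}
    (h : TestClose P Q ε) {T : Y → Z} (hT : Measurable T) : TestClose (P.map T) (Q.map T) ε := by
  intro φ hφ
  rw [integral_map hT.aemeasurable hφ.1.aestronglyMeasurable,
    integral_map hT.aemeasurable hφ.1.aestronglyMeasurable]
  exact h _ (hφ.comp hT)

lemma conv {E : Type*} [AddMonoid E] [MeasurableSpace E] [MeasurableAdd₂ E]
    {P Q : Measure E} [IsProbabilityMeasure P] [IsProbabilityMeasure Q] {ε : ℝ}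
    (h : TestClose P Q ε) (ρ : Measure E) [IsProbabilityMeasure ρ] :
    TestClose (P.conv ρ) (Q.conv ρ) ε := by
  intro φ hφ
  rw [integral_conv (hφ.integrable _), integral_conv (hφ.integrable _)]
  exact h _ ((hφ.comp measurable_add).integral_right ρ)

end TestClose

/-! ### Sums of independent vectors and exchange of summands -/

section ConvPow

variable {E : Type*} [AddCommMonoid E] [MeasurableSpace E] [MeasurableAdd₂ E]

/-- The law of the sum of `k` independent vectors of law `ν`. -/
noncomputable def convPow (ν : Measure E) : ℕ → Measure E
  | 0 => Measure.dirac 0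
  | k + 1 => ν.conv (convPow ν k)

instance isProbabilityMeasure_convPow (ν : Measure E) [IsProbabilityMeasure ν] (k : ℕ) :
    IsProbabilityMeasure (convPow ν k) := by
  induction k with
  | zero => unfold convPow; infer_instance
  | succ k ih => unfold convPow; infer_instance

/-- Lindeberg's telescoping. While one summand is exchanged, the others act as further independent
noise and cannot increase the distance, so a single copy of `ρ` serves every exchange. -/
lemma testClose_convPow {ν₁ ν₂ ρ : Measure E} [IsProbabilityMeasure ν₁] [IsProbabilityMeasure ν₂]
    [IsProbabilityMeasure ρ] {ε : ℝ} (h : TestClose (ν₁.conv ρ) (ν₂.conv ρ) ε) (k : ℕ) :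
    TestClose ((convPow ν₁ k).conv ρ) ((convPow ν₂ k).conv ρ) (k * ε) := by
  induction k with
  | zero => intro φ _; simp [convPow]
  | succ k ih =>
    have e1 : (convPow ν₁ (k + 1)).conv ρ = (ν₁.conv ρ).conv (convPow ν₁ k) := by
      rw [convPow, Measure.conv_assoc, Measure.conv_comm (convPow ν₁ k) ρ, Measure.conv_assoc]
    have e2 : (ν₂.conv ρ).conv (convPow ν₁ k) = ((convPow ν₁ k).conv ρ).conv ν₂ := by
      rw [Measure.conv_comm, Measure.conv_comm ν₂, ← Measure.conv_assoc]
    have e3 : (convPow ν₂ (k + 1)).conv ρ = ((convPow ν₂ k).conv ρ).conv ν₂ := by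
      rw [convPow, Measure.conv_assoc, Measure.conv_comm]
    rw [e1, e3]
    have h1 := h.conv (convPow ν₁ k)
    rw [e2] at h1
    have h2 := h1.trans (ih.conv ν₂)
    convert h2 using 1
    push_cast; ring

lemma map_sum_pi {X : Type*} [MeasurableSpace X] (D : Measure X) [IsProbabilityMeasure D]
    {b : X → E} (hb : Measurable b) (k : ℕ) :
    (Measure.pi fun _ : Fin k => D).map (fun S => ∑ i, b (S i)) = convPow (D.map b) k := by
  induction k with
  | zero => simp [convPow, Measure.map_const]
  | succ k ih =>
    have hk (k : ℕ) : Measurable fun S : Fin k → X => ∑ i, b (S i) :=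
      Finset.measurable_sum _ fun i _ => hb.comp (measurable_pi_apply i)
    have hp := (measurePreserving_piFinSuccAbove (fun _ : Fin (k + 1) => D) 0).symm
    have := Measure.isProbabilityMeasure_map (μ := D) hb.aemeasurable
    rw [convPow, ← ih, ← hp.map_eq, Measure.map_map (hk _) hp.measurable, Measure.conv,
      Measure.map_prod_map _ _ hb (hk k), Measure.map_map measurable_add (hb.prodMap (hk k))]
    congr 1
    ext p
    simp [Fin.sum_univ_succ, MeasurableEquiv.piFinSuccAbove]

lemma bind_map_add {Ω : Type*} [MeasurableSpace Ω] (P : Measure Ω) [IsProbabilityMeasure P]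
    (N : Measure E) [IsProbabilityMeasure N] {s : Ω → E} (hs : Measurable s) :
    P.bind (fun ω => N.map fun y => s ω + y) = (P.map s).conv N := by
  have hm : Measurable fun p : Ω × E => s p.1 + p.2 := (hs.comp measurable_fst).add measurable_snd
  have hk : Measurable fun ω => N.map fun y => s ω + y := by
    refine Measure.measurable_of_measurable_coe _ fun B hB => ?_
    simp_rw [Measure.map_apply (measurable_const_add _) hB]
    exact measurable_measure_prodMk_left (hm hB)
  ext B hB
  have e : (P.map s).conv N = (P.prod N).map fun p => s p.1 + p.2 := by
    have h := Measure.map_prod_map P N hs measurable_id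
    rw [Measure.map_id] at h
    rw [Measure.conv, h, Measure.map_map measurable_add (hs.prodMap measurable_id)]
    rfl
  rw [Measure.bind_apply hB hk.aemeasurable, e, Measure.map_apply hm hB,
    Measure.prod_apply (hm hB)]
  refine lintegral_congr fun ω => ?_
  rw [Measure.map_apply (measurable_const_add _) hB]
  rfl

end ConvPow

/-! ### Second order expansion under Gaussian noise -/

section Lindeberg

variable {E : Type*} [NormedAddCommGroup E] [InnerProductSpace ℝ E]

/-- The second order Taylor polynomial in `a` of the density of `N(a, I)` with respect to
`N(0, I)`. -/
noncomputable def hermiteQuad (u a : E) : ℝ :=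
  1 + inner ℝ u a + ((inner ℝ u a) ^ 2 - ‖a‖ ^ 2) / 2

/-- An integrable bound for the Taylor remainder. -/
noncomputable def remainderBound (u : E) : ℝ := 2 * (‖u‖ + 1) ^ 3 * Real.exp (‖u‖ + 1)

/-- The product form gives integrability for the product measure from moments of each factor. -/
lemma abs_hermiteQuad_le (u a : E) :
    |hermiteQuad u a| ≤ (1 + ‖u‖ + ‖u‖ ^ 2) * (1 + ‖a‖ + ‖a‖ ^ 2) := by
  have h1 := abs_real_inner_le_norm u a
  have h2 : (inner ℝ u a) ^ 2 ≤ (‖u‖ * ‖a‖) ^ 2 := by rw [← sq_abs]; gcongr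
  have h3 : 0 ≤ ‖u‖ * ‖a‖ := by positivity
  have := abs_le.1 h1
  have hu := norm_nonneg u
  have ha := norm_nonneg a
  rw [hermiteQuad, abs_le]
  constructor <;> nlinarith [mul_nonneg hu (sq_nonneg ‖a‖), mul_nonneg ha (sq_nonneg ‖u‖),
    sq_nonneg (inner ℝ u a), mul_nonneg (sq_nonneg ‖u‖) (sq_nonneg ‖a‖)]

lemma abs_exp_sub_hermiteQuad_le (u : E) {a : E} (ha : ‖a‖ ≤ 1) :
    |Real.exp (inner ℝ u a - ‖a‖ ^ 2 / 2) - hermiteQuad u a| ≤ ‖a‖ ^ 3 * remainderBound u := by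
  have hu := norm_nonneg u
  have ha0 := norm_nonneg a
  set i := (inner ℝ u a : ℝ) with hi
  have h1 : |i| ≤ ‖u‖ * ‖a‖ := abs_real_inner_le_norm u a
  set x : ℝ := i - ‖a‖ ^ 2 / 2 with hx
  have hxb : |x| ≤ ‖a‖ * (‖u‖ + 1) := by
    have h2 : |x| ≤ |i| + ‖a‖ ^ 2 / 2 := by
      rw [hx]; refine (abs_sub _ _).trans ?_
      rw [abs_of_nonneg (show 0 ≤ ‖a‖ ^ 2 / 2 by positivity)]
    nlinarith
  have hxb' : |x| ≤ ‖u‖ + 1 := hxb.trans (mul_le_of_le_one_left (by positivity) ha)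
  have hr : |Real.exp x - (1 + x + x ^ 2 / 2)| ≤ |x| ^ 3 * Real.exp |x| := by
    have h := Complex.norm_exp_sub_sum_le_norm_mul_exp (x : ℂ) 3
    have e : Complex.exp x - ∑ m ∈ Finset.range 3, (x : ℂ) ^ m / (m.factorial : ℂ) =
        ((Real.exp x - (1 + x + x ^ 2 / 2) : ℝ) : ℂ) := by
      simp [Finset.sum_range_succ, Nat.factorial]
    rwa [e, Complex.norm_real, Complex.norm_real, Real.norm_eq_abs, Real.norm_eq_abs] at h
  have hr' : |x| ^ 3 * Real.exp |x| ≤ ‖a‖ ^ 3 * ((‖u‖ + 1) ^ 3 * Real.exp (‖u‖ + 1)) := by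
    calc |x| ^ 3 * Real.exp |x| ≤ (‖a‖ * (‖u‖ + 1)) ^ 3 * Real.exp (‖u‖ + 1) := by gcongr
      _ = _ := by ring
  -- Squaring `x` produces terms of order three and four in `a` beyond the quadratic polynomial.
  have hd : 1 + x + x ^ 2 / 2 - hermiteQuad u a = (‖a‖ ^ 4 / 4 - ‖a‖ ^ 2 * i) / 2 := by
    rw [hermiteQuad, ← hi, hx]; ring
  have hd' : |1 + x + x ^ 2 / 2 - hermiteQuad u a| ≤ ‖a‖ ^ 3 * (‖u‖ + 1) := by
    have h2 := abs_le.1 h1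
    have h3 : ‖a‖ ^ 4 ≤ ‖a‖ ^ 3 := pow_le_pow_of_le_one ha0 ha (by norm_num)
    have h4 : ‖a‖ ^ 2 * |i| ≤ ‖a‖ ^ 3 * ‖u‖ := by
      calc ‖a‖ ^ 2 * |i| ≤ ‖a‖ ^ 2 * (‖u‖ * ‖a‖) := by gcongr
        _ = _ := by ring
    have h5 : |‖a‖ ^ 2 * i| ≤ ‖a‖ ^ 3 * ‖u‖ := by
      rwa [abs_mul, abs_of_nonneg (sq_nonneg ‖a‖)]
    have h6 := abs_le.1 h5
    have h7 : 0 ≤ ‖a‖ ^ 3 * ‖u‖ := by positivity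
    have h8 : 0 ≤ ‖a‖ ^ 4 := by positivity
    rw [hd, abs_le]
    constructor <;> linarith
  have hq : ‖u‖ + 1 ≤ (‖u‖ + 1) ^ 3 * Real.exp (‖u‖ + 1) := by
    have h3 : (1 : ℝ) ≤ Real.exp (‖u‖ + 1) := Real.one_le_exp (by positivity)
    have h4 : ‖u‖ + 1 ≤ (‖u‖ + 1) ^ 3 := le_self_pow₀ (by linarith) (by norm_num)
    calc ‖u‖ + 1 ≤ (‖u‖ + 1) ^ 3 * 1 := by linarith
      _ ≤ _ := by gcongr
  calc |Real.exp x - hermiteQuad u a|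
      ≤ |Real.exp x - (1 + x + x ^ 2 / 2)| + |1 + x + x ^ 2 / 2 - hermiteQuad u a| :=
        abs_sub_le _ _ _
    _ ≤ ‖a‖ ^ 3 * ((‖u‖ + 1) ^ 3 * Real.exp (‖u‖ + 1)) + ‖a‖ ^ 3 * (‖u‖ + 1) :=
        add_le_add (hr.trans hr') hd'
    _ ≤ ‖a‖ ^ 3 * ((‖u‖ + 1) ^ 3 * Real.exp (‖u‖ + 1)) +
        ‖a‖ ^ 3 * ((‖u‖ + 1) ^ 3 * Real.exp (‖u‖ + 1)) := by gcongr
    _ = _ := by rw [remainderBound]; ring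

lemma abs_hermiteQuad_le_of_one_le (u : E) {a : E} (ha : 1 ≤ ‖a‖) :
    |hermiteQuad u a| ≤ 3 / 2 * ‖a‖ ^ 3 * remainderBound u := by
  have hu := norm_nonneg u
  have h1 : 1 + ‖u‖ + ‖u‖ ^ 2 ≤ (‖u‖ + 1) ^ 3 := by nlinarith [pow_nonneg hu 3]
  have h2 : 1 + ‖a‖ + ‖a‖ ^ 2 ≤ 3 * ‖a‖ ^ 3 := by
    have h3 : ‖a‖ ^ 2 ≤ ‖a‖ ^ 3 := pow_le_pow_right₀ ha (by norm_num)
    have h4 : ‖a‖ ≤ ‖a‖ ^ 3 := le_self_pow₀ ha (by norm_num)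
    linarith
  have h3 : (1 : ℝ) ≤ Real.exp (‖u‖ + 1) := Real.one_le_exp (by positivity)
  calc |hermiteQuad u a| ≤ (1 + ‖u‖ + ‖u‖ ^ 2) * (1 + ‖a‖ + ‖a‖ ^ 2) := abs_hermiteQuad_le u a
    _ ≤ (‖u‖ + 1) ^ 3 * (3 * ‖a‖ ^ 3) := by gcongr
    _ = (‖u‖ + 1) ^ 3 * 1 * (3 * ‖a‖ ^ 3) := by ring
    _ ≤ (‖u‖ + 1) ^ 3 * Real.exp (‖u‖ + 1) * (3 * ‖a‖ ^ 3) := by gcongr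
    _ = _ := by rw [remainderBound]; ring

variable [FiniteDimensional ℝ E] [MeasurableSpace E] [BorelSpace E]

/-- Fernique's theorem: some `exp (C * ‖u‖ ^ 2)` is integrable and dominates the bound, which grows
at most like a multiple of `exp (2 * ‖u‖)`. -/
lemma integrable_remainderBound : Integrable (remainderBound (E := E)) (stdGaussian E) := by
  obtain ⟨C, hC, h⟩ := IsGaussian.exists_integrable_exp_sq (stdGaussian E)
  refine Integrable.mono' (h.const_mul (12 * Real.exp (2 + C⁻¹)))
    (by unfold remainderBound; fun_prop) (.of_forall fun u => ?_)
  have h0 : 0 ≤ ‖u‖ := norm_nonneg u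
  have h1 : (‖u‖ + 1) ^ 3 ≤ 6 * Real.exp (‖u‖ + 1) := by
    have := Real.pow_div_factorial_le_exp (x := ‖u‖ + 1) (by positivity) 3
    rw [div_le_iff₀ (by positivity)] at this
    norm_num [Nat.factorial] at this
    linarith
  have h2 : 2 * ‖u‖ ≤ C * ‖u‖ ^ 2 + C⁻¹ := by
    have h3 : C * (‖u‖ - C⁻¹) ^ 2 = C * ‖u‖ ^ 2 - 2 * ‖u‖ + C⁻¹ := by field_simp; ring
    have h4 : 0 ≤ C * (‖u‖ - C⁻¹) ^ 2 := by positivity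
    linarith
  rw [remainderBound, Real.norm_of_nonneg (by positivity)]
  calc 2 * (‖u‖ + 1) ^ 3 * Real.exp (‖u‖ + 1)
      ≤ 2 * (6 * Real.exp (‖u‖ + 1)) * Real.exp (‖u‖ + 1) := by gcongr
    _ = 12 * Real.exp (‖u‖ + 1 + (‖u‖ + 1)) := by rw [Real.exp_add (‖u‖ + 1)]; ring
    _ ≤ 12 * Real.exp (2 + C⁻¹ + C * ‖u‖ ^ 2) := by
        have := Real.exp_le_exp.2 (show ‖u‖ + 1 + (‖u‖ + 1) ≤ 2 + C⁻¹ + C * ‖u‖ ^ 2 by linarith)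
        linarith
    _ = _ := by rw [Real.exp_add (2 + C⁻¹)]; ring

lemma measurable_hermiteQuad : Measurable fun p : E × E => hermiteQuad p.1 p.2 := by
  unfold hermiteQuad; fun_prop

lemma integrable_norm_quad {ν : Measure E} [IsProbabilityMeasure ν]
    (h : Integrable (fun a => ‖a‖ ^ 3) ν) :
    Integrable (fun a => 1 + ‖a‖ + ‖a‖ ^ 2) ν := by
  refine Integrable.mono' ((integrable_const 3).add (h.const_mul 2)) (by fun_prop)
    (.of_forall fun a => ?_)
  have ha := norm_nonneg a
  rw [Real.norm_of_nonneg (by positivity), Pi.add_apply]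
  nlinarith [sq_nonneg (‖a‖ - 1), mul_nonneg ha (sq_nonneg (‖a‖ - 1))]

lemma integrable_norm_pow_of_isGaussian (ν : Measure E) [IsGaussian ν] :
    Integrable (fun a => ‖a‖ ^ 3) ν :=
  (IsGaussian.memLp_id ν 3 (by norm_num)).integrable_norm_pow (by norm_num)

lemma integrable_test_mul_hermiteQuad {φ : E → ℝ} (h : IsTest φ) {ν : Measure E}
    [IsProbabilityMeasure ν] (hν : Integrable (fun a => ‖a‖ ^ 3) ν) :
    Integrable (fun p : E × E => φ p.1 * hermiteQuad p.1 p.2) ((stdGaussian E).prod ν) := by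
  have hi := (integrable_norm_quad (integrable_norm_pow_of_isGaussian (stdGaussian E))).mul_prod
    (integrable_norm_quad hν)
  refine Integrable.mono' hi
    ((h.1.comp measurable_fst).mul measurable_hermiteQuad).aestronglyMeasurable
    (.of_forall fun p => ?_)
  rw [norm_mul]
  exact (mul_le_of_le_one_left (norm_nonneg _) (h.norm_le _)).trans (abs_hermiteQuad_le _ _)

/-- Cameron–Martin moves the shift from the test to a smooth density, so the test itself needs no
regularity. -/
lemma integral_stdGaussian_comp_add {φ : E → ℝ} (h : IsTest φ) (a : E) :
    Integrable (fun u => φ u * Real.exp (inner ℝ u a - ‖a‖ ^ 2 / 2)) (stdGaussian E) ∧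
    ∫ u, φ (a + u) ∂(stdGaussian E) =
      ∫ u, φ u * Real.exp (inner ℝ u a - ‖a‖ ^ 2 / 2) ∂(stdGaussian E) := by
  have hm : Measurable fun u : E => ENNReal.ofReal (Real.exp (inner ℝ u a - ‖a‖ ^ 2 / 2)) := by
    fun_prop
  have hi := h.integrable (isoGauss a 1)
  have e : ∫ u, φ (a + u) ∂(stdGaussian E) = ∫ y, φ y ∂(isoGauss a 1) := by
    rw [isoGauss, integral_map (by fun_prop) h.1.aestronglyMeasurable]; simp
  rw [e, isoGauss_one_eq_withDensity] at *
  rw [integrable_withDensity_iff_integrable_smul' hm (by simp)] at hi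
  rw [integral_withDensity_eq_integral_toReal_smul hm (by simp)]
  simp only [ENNReal.toReal_ofReal (Real.exp_nonneg _), smul_eq_mul, mul_comm (Real.exp _)] at hi ⊢
  exact ⟨hi, trivial⟩

/-- Second order expansion of a Gaussian average of a test, with a remainder that is uniform in the
test. -/
lemma exists_abs_integral_sub_hermiteQuad_le : ∃ M : ℝ, 0 ≤ M ∧ ∀ φ : E → ℝ, IsTest φ → ∀ a : E,
    |∫ u, φ (a + u) ∂(stdGaussian E) - ∫ u, φ u * hermiteQuad u a ∂(stdGaussian E)| ≤
      M * ‖a‖ ^ 3 := by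
  have hW := integrable_remainderBound (E := E)
  have hW0 (u : E) : 0 ≤ remainderBound u := by unfold remainderBound; positivity
  have hWi : 0 ≤ ∫ u, remainderBound u ∂(stdGaussian E) := integral_nonneg hW0
  refine ⟨1 + 3 / 2 * ∫ u, remainderBound u ∂(stdGaussian E), by positivity, fun φ h a => ?_⟩
  obtain ⟨hi, e⟩ := integral_stdGaussian_comp_add h a
  have hq : Integrable (fun u => φ u * hermiteQuad u a) (stdGaussian E) := by
    refine Integrable.mono' ((integrable_norm_quad (integrable_norm_pow_of_isGaussian
      (stdGaussian E))).mul_const (1 + ‖a‖ + ‖a‖ ^ 2))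
      (h.1.mul (measurable_hermiteQuad.comp (measurable_prodMk_right))).aestronglyMeasurable
      (.of_forall fun u => ?_)
    rw [norm_mul]
    exact (mul_le_of_le_one_left (norm_nonneg _) (h.norm_le _)).trans (abs_hermiteQuad_le _ _)
  rw [e]
  rcases le_total ‖a‖ 1 with ha | ha
  · rw [← integral_sub hi hq]
    calc _ ≤ ∫ u, ‖a‖ ^ 3 * remainderBound u ∂(stdGaussian E) := by
          rw [← Real.norm_eq_abs]
          refine norm_integral_le_of_norm_le (hW.const_mul _) (.of_forall fun u => ?_)
          rw [← mul_sub, norm_mul]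
          exact (mul_le_of_le_one_left (norm_nonneg _) (h.norm_le _)).trans
            (abs_exp_sub_hermiteQuad_le u ha)
      _ = (∫ u, remainderBound u ∂(stdGaussian E)) * ‖a‖ ^ 3 := by
          rw [integral_const_mul, mul_comm]
      _ ≤ _ := by gcongr; linarith
  -- For `‖a‖ ≥ 1` no cancellation is needed: each term is separately `O(‖a‖ ^ 3)`.
  · have h1 : |∫ u, φ u * hermiteQuad u a ∂(stdGaussian E)| ≤
        3 / 2 * ‖a‖ ^ 3 * ∫ u, remainderBound u ∂(stdGaussian E) := by
      rw [← integral_const_mul, ← Real.norm_eq_abs]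
      refine norm_integral_le_of_norm_le (hW.const_mul _) (.of_forall fun u => ?_)
      rw [norm_mul]
      exact (mul_le_of_le_one_left (norm_nonneg _) (h.norm_le _)).trans
        (abs_hermiteQuad_le_of_one_le u ha)
    have h2 : |∫ u, φ u * Real.exp (inner ℝ u a - ‖a‖ ^ 2 / 2) ∂(stdGaussian E)| ≤ 1 := by
      rw [← e]
      have := (h.comp (measurable_const_add a)).integral_mem (stdGaussian E)
      rw [abs_of_nonneg this.1]; exact this.2
    have h3 : 1 ≤ ‖a‖ ^ 3 := one_le_pow₀ ha
    refine (abs_sub _ _).trans ?_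
    linarith

/-- Under standard Gaussian noise, two centred laws with the same covariance are close if their
third moments are small. -/
lemma exists_testClose_conv_stdGaussian : ∃ M : ℝ, 0 ≤ M ∧ ∀ ν₁ ν₂ : Measure E,
    ∀ [IsProbabilityMeasure ν₁] [IsProbabilityMeasure ν₂],
    Integrable (fun a => ‖a‖ ^ 3) ν₁ → Integrable (fun a => ‖a‖ ^ 3) ν₂ →
    (∀ u : E, ∫ a, inner ℝ u a ∂ν₁ = ∫ a, inner ℝ u a ∂ν₂) →
    (∀ u : E, ∫ a, (inner ℝ u a) ^ 2 ∂ν₁ = ∫ a, (inner ℝ u a) ^ 2 ∂ν₂) →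
    TestClose (ν₁.conv (stdGaussian E)) (ν₂.conv (stdGaussian E))
      (M * (∫ a, ‖a‖ ^ 3 ∂ν₁ + ∫ a, ‖a‖ ^ 3 ∂ν₂)) := by
  obtain ⟨M, hM, key⟩ := exists_abs_integral_sub_hermiteQuad_le (E := E)
  refine ⟨M, hM, fun ν₁ ν₂ _ _ h₁ h₂ hmean hcov φ h => ?_⟩
  -- both averages are close to the same quadratic approximation
  have approx (ν : Measure E) [IsProbabilityMeasure ν] (hν : Integrable (fun a => ‖a‖ ^ 3) ν) :
      |∫ y, φ y ∂(ν.conv (stdGaussian E)) -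
        ∫ u, φ u * ∫ a, hermiteQuad u a ∂ν ∂(stdGaussian E)| ≤ M * ∫ a, ‖a‖ ^ 3 ∂ν := by
    have hi := integrable_test_mul_hermiteQuad h hν
    have e : ∫ u, φ u * ∫ a, hermiteQuad u a ∂ν ∂(stdGaussian E) =
        ∫ a, ∫ u, φ u * hermiteQuad u a ∂(stdGaussian E) ∂ν := by
      rw [← integral_integral_swap hi]
      simp_rw [integral_const_mul]
    have ht : IsTest fun a => ∫ u, φ (a + u) ∂(stdGaussian E) :=
      (h.comp measurable_add).integral_right (stdGaussian E)
    rw [integral_conv (h.integrable _), e, ← integral_sub (ht.integrable ν) hi.integral_prod_right,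
      ← integral_const_mul, ← Real.norm_eq_abs]
    exact norm_integral_le_of_norm_le (hν.const_mul _) (.of_forall fun a => key φ h a)
  have hint (ν : Measure E) [IsProbabilityMeasure ν] (hν : Integrable (fun a => ‖a‖ ^ 3) ν)
      (u : E) : Integrable (fun a : E => (inner ℝ u a : ℝ)) ν ∧
      Integrable (fun a : E => (inner ℝ u a : ℝ) ^ 2) ν := by
    constructor
    · refine Integrable.mono' ((integrable_norm_quad hν).const_mul ‖u‖) (by fun_prop)
        (.of_forall fun a => (norm_inner_le_norm u a).trans ?_)
      gcongr
      nlinarith [sq_nonneg ‖a‖]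
    · refine Integrable.mono' ((integrable_norm_quad hν).const_mul (‖u‖ ^ 2)) (by fun_prop)
        (.of_forall fun a => ?_)
      rw [norm_pow]
      calc ‖(inner ℝ u a : ℝ)‖ ^ 2 ≤ (‖u‖ * ‖a‖) ^ 2 := by gcongr; exact norm_inner_le_norm u a
        _ = ‖u‖ ^ 2 * ‖a‖ ^ 2 := by ring
        _ ≤ _ := by
          gcongr
          linarith [norm_nonneg a]
  -- The term `‖a‖ ^ 2` is also fixed by the second moments, summed over an orthonormal basis.
  have hnorm (ν : Measure E) [IsProbabilityMeasure ν] (hν : Integrable (fun a => ‖a‖ ^ 3) ν) :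
      Integrable (fun a : E => ‖a‖ ^ 2) ν ∧ ∫ a, ‖a‖ ^ 2 ∂ν =
        ∑ i, ∫ a, (inner ℝ (stdOrthonormalBasis ℝ E i) a) ^ 2 ∂ν := by
    have e : (fun a : E => ‖a‖ ^ 2) =
        fun a => ∑ i, (inner ℝ (stdOrthonormalBasis ℝ E i) a) ^ 2 := by
      ext a; exact ((stdOrthonormalBasis ℝ E).sum_sq_inner_right a).symm
    rw [e]
    exact ⟨integrable_finsetSum _ fun i _ => (hint ν hν _).2,
      integral_finsetSum _ fun i _ => (hint ν hν _).2⟩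
  have hquad (ν : Measure E) [IsProbabilityMeasure ν] (hν : Integrable (fun a => ‖a‖ ^ 3) ν)
      (u : E) : ∫ a, hermiteQuad u a ∂ν = 1 + ∫ a, inner ℝ u a ∂ν +
        (∫ a, (inner ℝ u a) ^ 2 ∂ν -
          ∑ i, ∫ a, (inner ℝ (stdOrthonormalBasis ℝ E i) a) ^ 2 ∂ν) / 2 := by
    have i1 := (hint ν hν u).1
    have i2 := (hint ν hν u).2
    have i3 := (hnorm ν hν).1
    have i4 : Integrable (fun a : E => 1 + (inner ℝ u a : ℝ)) ν := (integrable_const _).add i1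
    have i5 : Integrable (fun a : E => ((inner ℝ u a : ℝ) ^ 2 - ‖a‖ ^ 2) / 2) ν :=
      (i2.sub i3).div_const 2
    unfold hermiteQuad
    rw [integral_add i4 i5, integral_add (integrable_const _) i1, integral_div, integral_sub i2 i3, (hnorm ν hν).2]
    simp
  have he : (fun u => φ u * ∫ a, hermiteQuad u a ∂ν₁) = fun u => φ u * ∫ a, hermiteQuad u a ∂ν₂ := by
    ext u
    rw [hquad ν₁ h₁, hquad ν₂ h₂, hmean, hcov]
    simp_rw [hcov]
  have a1 := approx ν₁ h₁
  have a2 := approx ν₂ h₂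
  rw [he] at a1
  rw [abs_sub_comm] at a2
  rw [mul_add]
  exact (abs_sub_le _ _ _).trans (add_le_add a1 a2)

end Lindeberg

/-! ### Noisy SGD compared with the central limit model -/

section NoisySGD

open Matrix

variable {d : ℕ}

local notation:max "𝔼" d:max => EuclideanSpace ℝ (Fin d)

lemma convPow_multivariateGaussian {T : Matrix (Fin d) (Fin d) ℝ} (hT : T.PosSemidef) (k : ℕ) :
    convPow (multivariateGaussian 0 T) k = multivariateGaussian 0 ((k : ℝ) • T) := by
  induction k with
  | zero => simp [convPow, multivariateGaussian, CFC.sqrt_zero, Measure.map_const]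
  | succ k ih =>
    rw [convPow, ih, multivariateGaussian_conv _ _ hT (hT.smul (Nat.cast_nonneg (α := ℝ) k))]
    congr 1
    · simp
    · push_cast; rw [add_smul, one_smul, add_comm]

lemma map_convPow_multivariateGaussian {T : Matrix (Fin d) (Fin d) ℝ} (hT : T.PosSemidef) (k : ℕ)
    (c : 𝔼 d) {τ : ℝ} (hτ : 0 < τ) :
    ((convPow (multivariateGaussian 0 T) k).conv (stdGaussian (𝔼 d))).map (fun z => c + τ • z) =
      multivariateGaussian c ((τ ^ 2 * k) • T + τ ^ 2 • 1) := by
  have hk := hT.smul (Nat.cast_nonneg (α := ℝ) k)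
  have h := multivariateGaussian_map_smul_add τ (τ⁻¹ • c) 0 (hk.add PosSemidef.one)
  rw [convPow_multivariateGaussian hT, ← multivariateGaussian_zero_one,
    multivariateGaussian_conv _ _ hk PosSemidef.one, add_zero]
  simp only [smul_add, smul_smul, mul_inv_cancel₀ hτ.ne', one_smul, add_zero] at h
  exact h

variable {X : Type*} [MeasurableSpace X] {D : Measure X} {g θ : X → 𝔼 d} {C : ℝ≥0∞}

/-- Bounded susceptibility bounds the centred gradients almost everywhere, so third moments exist
even without clipping. -/
lemma ae_norm_sub_gradMean_le (hcov : (gradCov D θ).PosDef) {K : ℝ}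
    (hK : ∀ᵐ x ∂D, susceptibility D θ x ≤ K) :
    ∃ R : ℝ, 0 ≤ R ∧ ∀ᵐ x ∂D, ‖θ x - gradMean D θ‖ ≤ R := by
  set A := toEuclideanCLM (𝕜 := ℝ) (CFC.sqrt (gradCov D θ))
  refine ⟨‖A‖ * √K, by positivity, ?_⟩
  filter_upwards [hK] with x hx
  rw [← (toEuclideanCLM_sqrt_inv hcov).2 (θ x - gradMean D θ)]
  refine (A.le_opNorm _).trans ?_
  gcongr
  exact Real.le_sqrt_of_sq_le hx

variable [IsProbabilityMeasure D]

/-- Factoring `τ` out of both sum and noise makes the noise standard Gaussian. -/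
lemma bind_noisy_sum {b : X → 𝔼 d} (hb : Measurable b) (k : ℕ) (c : 𝔼 d) (τ : ℝ)
    {s : (Fin k → X) → 𝔼 d} (hs : ∀ S, s S = c + τ • ∑ i, b (S i)) :
    (Measure.pi fun _ : Fin k => D).bind (fun S =>
      (multivariateGaussian 0 (τ ^ 2 • (1 : Matrix (Fin d) (Fin d) ℝ))).map fun y => s S + y) =
    ((convPow (D.map b) k).conv (stdGaussian (𝔼 d))).map fun z => c + τ • z := by
  have hk : Measurable fun S : Fin k → X => ∑ i, b (S i) :=
    Finset.measurable_sum _ fun i _ => hb.comp (measurable_pi_apply i)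
  have hT : Measurable fun z : 𝔼 d => c + τ • z := by fun_prop
  have hsm : Measurable s := by rw [funext hs]; exact hT.comp hk
  have := Measure.isProbabilityMeasure_map (μ := D) hb.aemeasurable
  have e1 : (Measure.pi fun _ : Fin k => D).map s =
      (convPow (D.map b) k).map fun z => c + τ • z := by
    rw [← map_sum_pi D hb, Measure.map_map hT hk, funext hs]
    rfl
  have e2 : multivariateGaussian 0 (τ ^ 2 • (1 : Matrix (Fin d) (Fin d) ℝ)) =
      (stdGaussian (𝔼 d)).map fun z => τ • z := by
    have h := multivariateGaussian_map_smul_add τ 0 0 (PosSemidef.one (n := Fin d) (R := ℝ))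
    simp only [zero_add, smul_zero, multivariateGaussian_zero_one] at h
    exact h.symm
  have hm : Measurable fun z : 𝔼 d => τ • z := by fun_prop
  rw [bind_map_add _ _ hsm, e1, e2, Measure.conv, Measure.map_prod_map _ _ hT hm,
    Measure.map_map measurable_add (hT.prodMap hm), Measure.conv, Measure.map_map hT measurable_add]
  congr 1
  ext1 p
  simp [add_assoc]

lemma measurable_clip (C : ℝ≥0∞) : Measurable (clip C : 𝔼 d → 𝔼 d) := by
  unfold clip
  fun_prop

lemma nullLaw_noisySGD_eq (hθm : Measurable θ) (hθ : θ = fun x => clip C (g x)) (m : ℕ) {τ : ℝ}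
    (hτ : 0 < τ) :
    nullLaw D (m := m) (noisySGD g C τ) =
      ((convPow (D.map fun x => (((m : ℝ) + 1) * τ)⁻¹ • (θ x - gradMean D θ)) (m + 1)).conv
        (stdGaussian (𝔼 d))).map fun z => gradMean D θ + τ • z := by
  rw [nullLaw]
  refine bind_noisy_sum (by fun_prop) (m + 1) (gradMean D θ) τ
    (s := fun S => (1 / ((m + 1 : ℕ) : ℝ)) • ∑ i, clip C (g (S i))) fun S => ?_
  have hn : (m : ℝ) + 1 ≠ 0 := by positivity
  have e (i : Fin (m + 1)) : clip C (g (S i)) = θ (S i) := by rw [hθ]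
  simp only [e]
  rw [← Finset.smul_sum, smul_smul, Finset.sum_sub_distrib, Finset.sum_const, Finset.card_univ,
    Fintype.card_fin, ← Nat.cast_smul_eq_nsmul ℝ,
    show τ * (((m : ℝ) + 1) * τ)⁻¹ = 1 / ((m + 1 : ℕ) : ℝ) by push_cast; field_simp,
    smul_sub, smul_smul, one_div_mul_cancel (by exact_mod_cast hn), one_smul]
  abel

lemma memberLaw_noisySGD_eq (hθm : Measurable θ) (hθ : θ = fun x => clip C (g x)) (m : ℕ) {τ : ℝ}
    (hτ : 0 < τ) (x : X) :
    memberLaw D (m := m) (noisySGD g C τ) x =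
      ((convPow (D.map fun x => (((m : ℝ) + 1) * τ)⁻¹ • (θ x - gradMean D θ)) m).conv
        (stdGaussian (𝔼 d))).map
        fun z => gradMean D θ + ((m : ℝ) + 1)⁻¹ • (θ x - gradMean D θ) + τ • z := by
  rw [memberLaw]
  refine bind_noisy_sum (by fun_prop) m
    (gradMean D θ + ((m : ℝ) + 1)⁻¹ • (θ x - gradMean D θ)) τ
    (s := fun S => (1 / ((m + 1 : ℕ) : ℝ)) •
      ∑ i, clip C (g ((Fin.cons x S : Fin (m + 1) → X) i))) fun S => ?_
  have hn : (m : ℝ) + 1 ≠ 0 := by positivity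
  have e (y : X) : clip C (g y) = θ y := by rw [hθ]
  simp only [e, Fin.sum_univ_succ, Fin.cons_zero, Fin.cons_succ]
  rw [← Finset.smul_sum, smul_smul, Finset.sum_sub_distrib, Finset.sum_const, Finset.card_univ,
    Fintype.card_fin, ← Nat.cast_smul_eq_nsmul ℝ,
    show τ * (((m : ℝ) + 1) * τ)⁻¹ = ((m : ℝ) + 1)⁻¹ by field_simp, one_div]
  push_cast
  have e2 : gradMean D θ = ((m : ℝ) + 1)⁻¹ • (((m : ℝ) + 1) • gradMean D θ) := by
    rw [smul_smul, inv_mul_cancel₀ hn, one_smul]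
  conv_rhs => enter [1, 1]; rw [e2]
  module

lemma integral_inner_sq_multivariateGaussian {S : Matrix (Fin d) (Fin d) ℝ} (hS : S.PosSemidef)
    (u : 𝔼 d) :
    ∫ a, (inner ℝ u a) ^ 2 ∂(multivariateGaussian 0 S) = u ⬝ᵥ S *ᵥ u := by
  have h0 : ∫ a, inner ℝ u a ∂(multivariateGaussian (0 : 𝔼 d) S) = 0 := by
    rw [integral_inner (IsGaussian.integrable_fun_id), integral_id_multivariateGaussian,
      inner_zero_right]
  rw [← covarianceBilin_multivariateGaussian (μ := 0) hS,
    covarianceBilin_apply_eq_cov IsGaussian.memLp_two_id, covariance_self (by fun_prop),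
    variance_eq_integral (by fun_prop), h0]
  simp

/-- One gradient can be replaced by a Gaussian vector with the same mean and covariance, under
standard Gaussian noise, at a cost of the third order in its scale. -/
lemma exists_testClose_gradient (hθm : Measurable θ) (hL2 : MemLp θ 2 D)
    (hcov : (gradCov D θ).PosDef) {K : ℝ} (hK : ∀ᵐ x ∂D, susceptibility D θ x ≤ K) :
    ∃ G : ℝ, 0 ≤ G ∧ ∀ h : ℝ, 0 < h →
      TestClose ((D.map fun x => h • (θ x - gradMean D θ)).conv (stdGaussian (𝔼 d)))
        ((multivariateGaussian 0 (h ^ 2 • gradCov D θ)).conv (stdGaussian (𝔼 d))) (G * h ^ 3) := by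
  have hps := hcov.posSemidef
  obtain ⟨M, hM, key⟩ := exists_testClose_conv_stdGaussian (E := 𝔼 d)
  obtain ⟨R, hR, hb⟩ := ae_norm_sub_gradMean_le hcov hK
  set ρ : ℝ := ∫ a, ‖a‖ ^ 3 ∂(multivariateGaussian (0 : 𝔼 d) (gradCov D θ))
  have hρ : 0 ≤ ρ := integral_nonneg fun a => by positivity
  refine ⟨M * (R ^ 3 + ρ), by positivity, fun h hh => ?_⟩
  have hbm : Measurable fun x => h • (θ x - gradMean D θ) := by fun_prop
  have := Measure.isProbabilityMeasure_map (μ := D) hbm.aemeasurable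
  have hθi : Integrable θ D := hL2.integrable (by norm_num)
  have hbb : ∀ᵐ x ∂D, ‖‖h • (θ x - gradMean D θ)‖ ^ 3‖ ≤ R ^ 3 * h ^ 3 := by
    filter_upwards [hb] with x hx
    rw [norm_pow, norm_norm, norm_smul, mul_pow, Real.norm_of_nonneg hh.le, mul_comm]
    gcongr
  have h1 : Integrable (fun a => ‖a‖ ^ 3) (D.map fun x => h • (θ x - gradMean D θ)) := by
    rw [integrable_map_measure (by fun_prop) hbm.aemeasurable]
    exact Integrable.of_bound (by fun_prop) _ hbb
  have hmean (u : 𝔼 d) : ∫ x, inner ℝ u (θ x) ∂D = inner ℝ u (gradMean D θ) :=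
    integral_inner hθi u
  refine fun φ hφ => (key _ _ h1 (integrable_norm_pow_of_isGaussian _) (fun u => ?_) (fun u => ?_)
    φ hφ).trans ?_
  · rw [integral_map hbm.aemeasurable (by fun_prop), integral_inner IsGaussian.integrable_fun_id,
      integral_id_multivariateGaussian, inner_zero_right]
    simp only [inner_smul_right, inner_sub_right]
    rw [integral_const_mul, integral_sub (hθi.const_inner u) (integrable_const _), hmean]
    simp
  · rw [integral_inner_sq_multivariateGaussian (hps.smul (sq_nonneg h)),
      integral_map hbm.aemeasurable (by fun_prop), smul_mulVec, dotProduct_smul,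
      dotProduct_gradCov hL2, variance_eq_integral (by fun_prop), hmean, smul_eq_mul,
      ← integral_const_mul]
    refine integral_congr_ae (.of_forall fun x => ?_)
    simp only [inner_smul_right, inner_sub_right]
    ring
  · have e1 : ∫ a, ‖a‖ ^ 3 ∂(D.map fun x => h • (θ x - gradMean D θ)) ≤ R ^ 3 * h ^ 3 := by
      rw [integral_map hbm.aemeasurable (by fun_prop)]
      have := norm_integral_le_of_norm_le (integrable_const _) hbb
      simp only [integral_const, probReal_univ, one_smul] at this
      exact (Real.le_norm_self _).trans this
    -- `N(0, h² Σ)` is the image of `N(0, Σ)` under scaling by `h`.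
    have e2 : ∫ a, ‖a‖ ^ 3 ∂(multivariateGaussian (0 : 𝔼 d) (h ^ 2 • gradCov D θ)) = ρ * h ^ 3 := by
      have e := multivariateGaussian_map_smul_add h 0 0 hps
      simp only [zero_add, smul_zero] at e
      rw [← e, integral_map (by fun_prop) (by fun_prop), ← integral_mul_const]
      refine integral_congr_ae (.of_forall fun x => ?_)
      simp only [norm_smul, mul_pow, Real.norm_of_nonneg hh.le]
      ring
    rw [e2, mul_assoc, add_mul]
    gcongr

/-- The output laws of noisy SGD are within `O(1 / n²)` of the central limit model. -/
lemma exists_testClose_noisySGD (hθm : Measurable θ) (hθ : θ = fun x => clip C (g x))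
    (hL2 : MemLp θ 2 D) (hcov : (gradCov D θ).PosDef) {K : ℝ}
    (hK : ∀ᵐ x ∂D, susceptibility D θ x ≤ K) {τ : ℝ} (hτ : 0 < τ) :
    ∃ G : ℝ, 0 ≤ G ∧ ∀ m : ℕ,
      TestClose (cltNullLaw D θ m (τ ^ 2 • 1)) (nullLaw D (m := m) (noisySGD g C τ))
        (G / ((m : ℝ) + 1) ^ 2) ∧
      ∀ x, TestClose (cltMemberLaw D θ m (τ ^ 2 • 1) x) (memberLaw D (m := m) (noisySGD g C τ) x)
        (G / ((m : ℝ) + 1) ^ 2) := by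
  have hps := hcov.posSemidef
  obtain ⟨G, hG, key⟩ := exists_testClose_gradient hθm hL2 hcov hK
  have hV : (τ ^ 2 • (1 : Matrix (Fin d) (Fin d) ℝ)).PosSemidef :=
    PosSemidef.one.smul (sq_nonneg τ)
  refine ⟨G / τ ^ 3, by positivity, fun m => ?_⟩
  set n : ℝ := (m : ℝ) + 1 with hn
  have hn0 : 0 < n := by positivity
  set h : ℝ := (n * τ)⁻¹ with hh
  have hh0 : 0 < h := by positivity
  have hbm : Measurable fun x => h • (θ x - gradMean D θ) := by fun_prop
  have := Measure.isProbabilityMeasure_map (μ := D) hbm.aemeasurable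
  have hT := hps.smul (sq_nonneg h)
  -- Used with `k = n` for the null law and `k = n - 1` for the member law, where the contribution
  -- of `x'` sits in the shift `c`. The `k ≤ n` exchanges cost `G * h ^ 3` each.
  have hclose (k : ℕ) (hk : (k : ℝ) ≤ n) (c : 𝔼 d) :
      TestClose (multivariateGaussian c ((τ ^ 2 * k) • (h ^ 2 • gradCov D θ) + τ ^ 2 • 1))
        (((convPow (D.map fun x => h • (θ x - gradMean D θ)) k).conv
          (stdGaussian (𝔼 d))).map fun z => c + τ • z) (G / τ ^ 3 / n ^ 2) := by
    intro φ hφ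
    rw [← map_convPow_multivariateGaussian hT k c hτ, abs_sub_comm]
    refine ((testClose_convPow (key h hh0) k).map (by fun_prop) φ hφ).trans ?_
    calc (k : ℝ) * (G * h ^ 3) ≤ n * (G * h ^ 3) := by gcongr
      _ = G / τ ^ 3 / n ^ 2 := by rw [hh]; field_simp
  refine ⟨?_, fun x => ?_⟩
  · rw [cltNullLaw_eq hps m hV, nullLaw_noisySGD_eq hθm hθ m hτ]
    convert hclose (m + 1) (by push_cast; rfl) (gradMean D θ) using 2
    rw [smul_smul]
    congr 2
    rw [hh]; push_cast; rw [← hn]; field_simp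
  · rw [cltMemberLaw_eq hps m hV, memberLaw_noisySGD_eq hθm hθ m hτ]
    convert hclose m (by linarith) _ using 2
    rw [smul_smul]
    congr 2
    rw [hh, hn]; field_simp

end NoisySGD

end MIP

/-! ### Assembly of the three claims -/

theorem theorem5p1 {X : Type*} [MeasurableSpace X] (D : Measure X) [IsProbabilityMeasure D]
    {d : ℕ} (hd : 1 ≤ d)
    (g : X → EuclideanSpace ℝ (Fin d)) (hg : Measurable g)
    (C : ℝ≥0∞) (hC : C ≠ 0) (τ : ℝ) (hτ : 0 ≤ τ)
    (θ : X → EuclideanSpace ℝ (Fin d)) (hθ : θ = fun x => MIP.clip C (g x))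
    (hL2 : MemLp θ 2 D) (hcov : (MIP.gradCov D θ).PosDef)
    (K : ℝ) (hK : ∀ᵐ x' ∂D, MIP.susceptibility D θ x' ≤ K) :
    -- one step of noisy SGD, in the central limit model, with batch size `n = m + 1 ≥ 2`
    (∀ m : ℕ, 1 ≤ m →
      MIP.IsMIP D (MIP.cltNullLaw D θ m (τ ^ 2 • 1)) (MIP.cltMemberLaw D θ m (τ ^ 2 • 1))
        (MIP.oneStepTradeoff d (MIP.nEff (m + 1) τ C) K)) ∧
    -- exact optimal trade-off of each test for noise of the shape of the gradient covariance
    (∀ m : ℕ, 1 ≤ m → ∀ σ : ℝ, ∀ x' : X, ∀ α ∈ Icc (0 : ℝ) 1,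
      MIP.tradeoff (MIP.cltNullLaw D θ m (σ ^ 2 • MIP.gradCov D θ))
          (MIP.cltMemberLaw D θ m (σ ^ 2 • MIP.gradCov D θ) x') α =
        MIP.oneStepTradeoff d (((m : ℝ) + 1) + σ ^ 2 * ((m : ℝ) + 1) ^ 2)
          (MIP.susceptibility D θ x') α) ∧
    -- the algorithm itself, without Gaussian model, for `τ > 0` and up to an error `B / n ^ 2`
    (0 < τ → ∃ B : ℝ, ∀ m : ℕ, 1 ≤ m →
      MIP.IsMIP D (MIP.nullLaw D (m := m) (MIP.noisySGD g C τ))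
        (MIP.memberLaw D (m := m) (MIP.noisySGD g C τ))
        (fun α => max 0 (MIP.oneStepTradeoff d (MIP.nEff (m + 1) τ C) K α
          - B / ((m : ℝ) + 1) ^ 2))) := by
  have hps := hcov.posSemidef
  have hV : (τ ^ 2 • (1 : Matrix (Fin d) (Fin d) ℝ)).PosSemidef :=
    Matrix.PosSemidef.one.smul (sq_nonneg τ)
  have hK0 := MIP.susceptibility_bound_nonneg hK
  obtain ⟨q, hq, hqV, hN⟩ := MIP.exists_nEff_eq hC τ hθ hL2 hcov
  have hp0 (m : ℕ) : IsProbabilityMeasure (MIP.cltNullLaw D θ m (τ ^ 2 • 1)) := by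
    rw [MIP.cltNullLaw_eq hps m hV]; infer_instance
  have hp1 (m : ℕ) (x : X) : IsProbabilityMeasure (MIP.cltMemberLaw D θ m (τ ^ 2 • 1) x) := by
    rw [MIP.cltMemberLaw_eq hps m hV]; infer_instance
  have hN2 (m : ℕ) (hm : 1 ≤ m) : 2 ≤ MIP.nEff (m + 1) τ C := by
    have hm1 : (1 : ℝ) ≤ m := by exact_mod_cast hm
    have : 0 ≤ q * ((m : ℝ) + 1) ^ 2 := by positivity
    rw [hN]; linarith
  have hle (m : ℕ) (hm : 1 ≤ m) (x : X) (hx : MIP.susceptibility D θ x ≤ K) (a : ℝ)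
      (ha : a ∈ Icc (0 : ℝ) 1) : MIP.oneStepTradeoff d (MIP.nEff (m + 1) τ C) K a ≤
      MIP.tradeoff (MIP.cltNullLaw D θ m (τ ^ 2 • 1)) (MIP.cltMemberLaw D θ m (τ ^ 2 • 1) x) a := by
    rw [hN]
    exact MIP.oneStepTradeoff_le_tradeoff_clt hd hcov hm hq hqV x hx ha
  refine ⟨fun m hm => ?_, fun m hm σ x α hα => MIP.tradeoff_clt_eq hd hcov hm (sq_nonneg σ) x hα,
    fun hτ0 => ?_⟩
  · obtain ⟨h1, h2, -⟩ := MIP.isTradeoff_oneStepTradeoff hd (hN2 m hm) hK0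
    exact MIP.isMIP_of_forall_le h1 h2 (hK.mono fun x hx => hle m hm x hx)
  · have hθm : Measurable θ := by rw [hθ]; exact (MIP.measurable_clip C).comp hg
    obtain ⟨G, hG, hclose⟩ := MIP.exists_testClose_noisySGD hθm hθ hL2 hcov hK hτ0
    set L : ℝ := 2 ^ d * Real.exp (K / 2) with hL
    have hL0 : 0 ≤ L := by positivity
    -- Both laws are off by `G / n²`: the level error is amplified by the Lipschitz constant `L`,
    -- the power error enters once.
    refine ⟨(L + 1) * G, fun m hm => ?_⟩
    obtain ⟨h1, h2, h3⟩ := MIP.isTradeoff_oneStepTradeoff hd (hN2 m hm) hK0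
    have hbm : Measurable fun x => (((m : ℝ) + 1) * τ)⁻¹ • (θ x - MIP.gradMean D θ) := by fun_prop
    have := Measure.isProbabilityMeasure_map (μ := D) hbm.aemeasurable
    have hp2 : IsProbabilityMeasure (MIP.nullLaw D (m := m) (MIP.noisySGD g C τ)) := by
      rw [MIP.nullLaw_noisySGD_eq hθm hθ m hτ0]
      exact Measure.isProbabilityMeasure_map (by fun_prop)
    have hp3 (x : X) : IsProbabilityMeasure (MIP.memberLaw D (m := m) (MIP.noisySGD g C τ) x) := by
      rw [MIP.memberLaw_noisySGD_eq hθm hθ m hτ0]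
      exact Measure.isProbabilityMeasure_map (by fun_prop)
    refine MIP.isMIP_of_forall_le (h1.max_sub (by positivity))
      (ContinuousOn.sup continuousOn_const (h2.sub continuousOn_const)) (hK.mono fun x hx a ha => ?_)
    refine max_le (MIP.tradeoff_nonneg ha) ?_
    rw [mul_div_assoc]
    exact MIP.sub_le_tradeoff_of_approx h3 hL0 (hle m hm x hx) (hclose m).1 ((hclose m).2 x) ha
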